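/- **Setting.** Let $d\ge 0$, $\mathbb T^d=\mathbb R^d/\mathbb Z^d$, $t<T$, $D\ge 0$. The spaces $C^k(\mathbb T^d;V)$ carry their usual norms. Let $\mathcal T:C^2(\mathbb T^d)\to C^1(\mathbb T^d;\mathbb R^d)$ be a bounded linear operator (the velocity operator, $u=\mathcal Tq$) and let $\mathcal T^*\cdot:C^1(\mathbb T^d;\mathbb R^d)\to C^0(\mathbb T^d)$ be a bounded linear operator which is its $L^2$-adjoint, $$\int_{\mathbb T^d} v\cdot\mathcal Tf\,dx=\int_{\mathbb T^d}(\mathcal T^*\cdot v)\,f\,dx\qquad\text{for all } f\in C^2(\mathbb T^d),\ v\in C^1(\mathbb T^d;\mathbb R^d).$$ Let $\mathcal F,\mathcal G:C^2(\mathbb T^d)\to\mathbb R$ have functional derivatives $F(\cdot,q)=\frac{\delta\mathcal F}{\delta q}(q,\cdot)$ and $G(\cdot,q)=\frac{\delta\mathcal G}{\delta q}(q,\cdot)$ in $C^0(\mathbb T^d)$ at every $q>0$, that is, $\frac{d}{d\varepsilon}\big|_{\varepsilon=0}\mathcal F(q+\varepsilon\eta)=\int F(x,q)\,\eta(x)\,dx$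 for all $\eta\in C^2(\mathbb T^d)$, and likewise for $\mathcal G$; suppose that $q\mapsto F(\cdot,q)$ is continuous from $\{q\in C^2(\mathbb T^d):q>0\}$ to $C^0(\mathbb T^d)$. **MFG-2 problem.** Given an initial state $q\in C^2(\mathbb T^d)$, minimize $$\mathcal I(q(\cdot),\alpha(\cdot))=\mathcal G(q_T)+\int_t^T\Big[\int_{\mathbb T^d}\tfrac12|\alpha_s(x)|^2q_s(x)\,dx+\mathcal F(q_s)\Big]ds$$ over all pairs with $s\mapsto q_s\in C^2(\mathbb T^d)$ and $s\mapsto\alpha_s\in C^1(\mathbb T^d;\mathbb R^d)$ continuous on $[t,T]$ and $q_s>0$, which satisfy $$\partial_sq_s+\nabla\cdot[(\mathcal Tq_s+\alpha_s)q_s]=D\Delta q_s,\quad t\le s\le T,\qquad q_t=q,$$ in the classical sense (one-sided time derivatives at $s=t$ and $s=T$). **Proposition.** If $(q_s,\alpha_s)_{t\le s\le T}$ is an optimal pair for this problem, then there is a curve $s\mapsto\varphi_s$, continuous from $[t,T]$ to $C^2(\mathbb T^d)$, such that $\alpha_s=\nabla\varphi_s$ for all $s\in[t,T]$ and $(q_s,\varphi_s)$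 is a classical solution of the MFG-2 system $$\begin{aligned} &\partial_sq_s+\nabla\cdot[(\mathcal Tq_s+\nabla\varphi_s)q_s]=D\Delta q_s,\quad t\le s\le T,\qquad q_t(x)=q(x),\\ &\partial_s\varphi_s+\tfrac12|\nabla\varphi_s|^2+\nabla\varphi_s\cdot\mathcal Tq_s+\mathcal T^*\cdot(\nabla\varphi_s\,q_s)+D\Delta\varphi_s=F(x,q_s),\quad t\le s\le T,\qquad \varphi_T(x)=-G(x,q_T). \end{aligned}$$ -/

import Mathlib

open Set MeasureTheory
open scoped BoundedContinuousFunction Gradient Laplacian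

noncomputable section

namespace MFG

/-- The Euclidean space `ℝ^d`; functions on the torus `𝕋^d = ℝ^d / ℤ^d` are represented by
`ℤ^d`-periodic functions on it. -/
abbrev Space (d : ℕ) : Type := EuclideanSpace ℝ (Fin d)

/-- `f` is `ℤ^d`-periodic. -/
def IsPeriodic {d : ℕ} {V : Type*} (f : Space d → V) : Prop :=
  ∀ (x : Space d) (i : Fin d), f (x + EuclideanSpace.single i 1) = f x

/-- The fundamental cube `[0,1)^d` of the torus. -/
def unitCube (d : ℕ) : Set (Space d) := {x | ∀ i, x i ∈ Ico (0 : ℝ) 1}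

/-- The integral over the torus `𝕋^d` of a periodic function. -/
def torusInt {d : ℕ} (f : Space d → ℝ) : ℝ := ∫ x in unitCube d, f x

/-- The divergence of a vector field on `ℝ^d`. -/
def divg {d : ℕ} (v : Space d → Space d) (x : Space d) : ℝ :=
  ∑ i : Fin d, (fderiv ℝ v x (EuclideanSpace.single i 1)) i

theorem IsPeriodic.iteratedFDeriv {d : ℕ} {V : Type*} [NormedAddCommGroup V] [NormedSpace ℝ V]
    {f : Space d → V} (hf : IsPeriodic f) (j : ℕ) : IsPeriodic (iteratedFDeriv ℝ j f) := by
  intro x i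
  rw [← iteratedFDeriv_comp_add_right]
  congr 1
  funext y
  exact hf y i

theorem IsPeriodic.exists_mem_Icc {d : ℕ} {V : Type*} {f : Space d → V} (hf : IsPeriodic f)
    (x : Space d) : ∃ y : Space d, (∀ i, y i ∈ Icc (0 : ℝ) 1) ∧ f y = f x := by
  have h1 : ∀ (i : Fin d) (n : ℤ) (x : Space d), f (x + EuclideanSpace.single i (n : ℝ)) = f x := by
    intro i n
    induction n using Int.induction_on with
    | zero =>
      intro x
      have e : x + EuclideanSpace.single i ((0 : ℤ) : ℝ) = x := by
        ext k
        by_cases hk : k = i <;> simp [hk]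
      rw [e]
    | succ n ih =>
      intro x
      have e : x + EuclideanSpace.single i (((n : ℤ) + 1 : ℤ) : ℝ)
          = (x + EuclideanSpace.single i ((n : ℤ) : ℝ)) + EuclideanSpace.single i 1 := by
        rw [add_assoc]; congr 1; ext k
        by_cases hk : k = i <;> simp [hk]
      rw [e, hf, ih]
    | pred n ih =>
      intro x
      have e : (x + EuclideanSpace.single i ((-(n : ℤ) - 1 : ℤ) : ℝ)) + EuclideanSpace.single i 1
          = x + EuclideanSpace.single i ((-(n : ℤ) : ℤ) : ℝ) := by
        rw [add_assoc]; congr 1; ext k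
        by_cases hk : k = i <;> simp [hk]
      rw [← hf, e, ih]
  have h2 : ∀ (S : Finset (Fin d)), ∃ y : Space d,
      (∀ i, y i = if i ∈ S then Int.fract (x i) else x i) ∧ f y = f x := by
    intro S
    induction S using Finset.induction_on with
    | empty => exact ⟨x, by simp, rfl⟩
    | insert a S ha ih =>
      obtain ⟨y, hy, hfy⟩ := ih
      refine ⟨y + EuclideanSpace.single a ((-⌊x a⌋ : ℤ) : ℝ), ?_, by rw [h1, hfy]⟩
      intro i
      by_cases hi : i = a
      · subst hi
        simp [hy, ha, Int.fract, sub_eq_add_neg]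
      · simp [hy, hi]
  obtain ⟨y, hy, hfy⟩ := h2 Finset.univ
  refine ⟨y, fun i => ?_, hfy⟩
  rw [hy i]
  simp [Int.fract_nonneg, (Int.fract_lt_one _).le]

theorem IsPeriodic.exists_bound {d : ℕ} {V : Type*} [NormedAddCommGroup V] {f : Space d → V}
    (hf : IsPeriodic f) (hc : Continuous f) : ∃ C : ℝ, ∀ x, ‖f x‖ ≤ C := by
  have hK : IsCompact {y : Space d | ∀ i, y i ∈ Icc (0 : ℝ) 1} := by
    have h : IsCompact (Set.pi univ (fun _ : Fin d => Icc (0 : ℝ) 1)) :=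
      isCompact_univ_pi fun _ => isCompact_Icc
    have h' := (EuclideanSpace.equiv (Fin d) ℝ).toHomeomorph.isCompact_preimage.2 h
    convert h' using 1
    ext y
    exact ⟨fun hy i _ => hy i, fun hy i => hy i (mem_univ i)⟩
  obtain ⟨C, hC⟩ := hK.exists_bound_of_continuousOn hc.continuousOn
  refine ⟨C, fun x => ?_⟩
  obtain ⟨y, hy, hyx⟩ := hf.exists_mem_Icc x
  rw [← hyx]
  exact hC y hy

/-- The linear space of `V`-valued functions of class `C^k` on the torus `𝕋^d`. -/
def torusCSubmodule (d k : ℕ) (V : Type) [NormedAddCommGroup V] [NormedSpace ℝ V] :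
    Submodule ℝ (Space d → V) where
  carrier := {f | ContDiff ℝ k f ∧ IsPeriodic f}
  zero_mem' := ⟨contDiff_const, fun _ _ => rfl⟩
  add_mem' := fun hf hg => ⟨hf.1.add hg.1, fun x i => by simp [hf.2 x i, hg.2 x i]⟩
  smul_mem' := fun c _ hf => ⟨contDiff_const.smul hf.1, fun x i => by simp [hf.2 x i]⟩

/-- The space `C^k(𝕋^d; V)`. -/
def TorusC (d k : ℕ) (V : Type) [NormedAddCommGroup V] [NormedSpace ℝ V] : Type :=
  torusCSubmodule d k V

namespace TorusC

variable {d k : ℕ} {V : Type} [NormedAddCommGroup V] [NormedSpace ℝ V]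

instance : AddCommGroup (TorusC d k V) := inferInstanceAs (AddCommGroup (torusCSubmodule d k V))

instance : Module ℝ (TorusC d k V) := inferInstanceAs (Module ℝ (torusCSubmodule d k V))

instance : FunLike (TorusC d k V) (Space d) V where
  coe f := f.1
  coe_injective := Subtype.coe_injective

theorem contDiff (f : TorusC d k V) : ContDiff ℝ k f := f.2.1

theorem isPeriodic (f : TorusC d k V) : IsPeriodic f := f.2.2

@[simp] theorem coe_add (f g : TorusC d k V) : ⇑(f + g) = ⇑f + ⇑g := rfl

@[simp] theorem coe_smul (c : ℝ) (f : TorusC d k V) : ⇑(c • f) = c • ⇑f := rfl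

/-- All derivatives of `f` up to order `k`, as bounded continuous functions. -/
def jet (d k : ℕ) (V : Type) [NormedAddCommGroup V] [NormedSpace ℝ V] :
    TorusC d k V →ₗ[ℝ]
      ((j : Fin (k + 1)) → (Space d →ᵇ (ContinuousMultilinearMap ℝ (fun _ : Fin j => Space d) V)))
    where
  toFun f j := BoundedContinuousFunction.ofNormedAddCommGroup (iteratedFDeriv ℝ (j : ℕ) f)
    (f.contDiff.continuous_iteratedFDeriv (by exact_mod_cast Nat.lt_succ_iff.1 j.2))
    ((f.isPeriodic.iteratedFDeriv j).exists_bound (f.contDiff.continuous_iteratedFDeriv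
      (by exact_mod_cast Nat.lt_succ_iff.1 j.2))).choose
    ((f.isPeriodic.iteratedFDeriv j).exists_bound (f.contDiff.continuous_iteratedFDeriv
      (by exact_mod_cast Nat.lt_succ_iff.1 j.2))).choose_spec
  map_add' f g := by
    funext j
    ext1 x
    have hj : ((j : ℕ) : WithTop ℕ∞) ≤ (k : WithTop ℕ∞) := by
      exact_mod_cast Nat.lt_succ_iff.1 j.2
    exact iteratedFDeriv_add_apply ((f.contDiff.of_le hj).contDiffAt)
      ((g.contDiff.of_le hj).contDiffAt)
  map_smul' c f := by
    funext j
    ext1 x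
    have hj : ((j : ℕ) : WithTop ℕ∞) ≤ (k : WithTop ℕ∞) := by
      exact_mod_cast Nat.lt_succ_iff.1 j.2
    exact iteratedFDeriv_const_smul_apply ((f.contDiff.of_le hj).contDiffAt)

theorem jet_apply (f : TorusC d k V) (j : Fin (k + 1)) (x : Space d) :
    jet d k V f j x = iteratedFDeriv ℝ (j : ℕ) f x := rfl

theorem jet_injective : Function.Injective (jet d k V) := by
  intro f g h
  apply DFunLike.coe_injective
  funext x
  have h0 : iteratedFDeriv ℝ 0 f x = iteratedFDeriv ℝ 0 g x :=
    congrArg (fun w => w (0 : Fin (k + 1)) x) h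
  have h1 := congrArg (fun m => m (fun i => i.elim0)) h0
  simpa only [iteratedFDeriv_zero_apply] using h1

/-- The usual `C^k` norm: the maximum over `j ≤ k` of the supremum of the norm of the `j`-th
derivative. -/
instance : NormedAddCommGroup (TorusC d k V) :=
  NormedAddCommGroup.induced (TorusC d k V) _ (jet d k V) jet_injective

instance : NormedSpace ℝ (TorusC d k V) :=
  NormedSpace.induced ℝ (TorusC d k V) _ (jet d k V)

/-- The gradient `∇φ ∈ C^1(𝕋^d; ℝ^d)` of `φ ∈ C^2(𝕋^d)`. -/
def grad (φ : TorusC d 2 ℝ) : TorusC d 1 (Space d) :=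
  ⟨∇ φ, by
    constructor
    · exact (InnerProductSpace.toDual ℝ (Space d)).symm.contDiff.comp
        (φ.contDiff.fderiv_right (m := 1) (by norm_num [one_add_one_eq_two]))
    · intro x i
      have h : fderiv ℝ φ (x + EuclideanSpace.single i 1) = fderiv ℝ φ x := by
        rw [← fderiv_comp_add_right]
        congr 1
        funext y
        exact φ.isPeriodic y i
      simp only [gradient, h]⟩

/-- The product `q v ∈ C^1(𝕋^d; ℝ^d)` of `q ∈ C^2(𝕋^d)` and `v ∈ C^1(𝕋^d; ℝ^d)`. -/
def mulField (q : TorusC d 2 ℝ) (v : TorusC d 1 (Space d)) : TorusC d 1 (Space d) :=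
  ⟨fun x => q x • v x,
    (q.contDiff.of_le (by norm_num)).smul v.contDiff,
    fun x i => by simp only [q.isPeriodic x i, v.isPeriodic x i]⟩

end TorusC

open TorusC

/-- `q` is strictly positive on the torus. -/
def Pos {d : ℕ} (q : TorusC d 2 ℝ) : Prop := ∀ x, 0 < q x

/-- `S` is the (formal) `L²`-adjoint of `𝒯`: `∫ v · 𝒯f dx = ∫ (S v) f dx`. -/
def IsL2Adjoint {d : ℕ} (𝒯 : TorusC d 2 ℝ →L[ℝ] TorusC d 1 (Space d))
    (S : TorusC d 1 (Space d) →L[ℝ] TorusC d 0 ℝ) : Prop :=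
  ∀ (f : TorusC d 2 ℝ) (v : TorusC d 1 (Space d)),
    torusInt (fun x => inner ℝ (v x) (𝒯 f x)) = torusInt (fun x => S v x * f x)

/-- `F(q, ·) = δΦ/δq (q, ·)` at every strictly positive `q`. -/
def IsFunctionalDerivative {d : ℕ} (Φ : TorusC d 2 ℝ → ℝ) (F : TorusC d 2 ℝ → TorusC d 0 ℝ) :
    Prop :=
  ∀ q : TorusC d 2 ℝ, Pos q → ∀ η : TorusC d 2 ℝ,
    HasDerivAt (fun ε : ℝ => Φ (q + ε • η)) (torusInt (fun x => F q x * η x)) 0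

/-- The right-hand side `DΔq - ∇·[(𝒯q + a) q]` of the controlled continuity equation. -/
def continuityRHS {d : ℕ} (𝒯 : TorusC d 2 ℝ →L[ℝ] TorusC d 1 (Space d)) (D : ℝ)
    (q : TorusC d 2 ℝ) (a : TorusC d 1 (Space d)) (x : Space d) : ℝ :=
  D * (Δ (q : Space d → ℝ)) x - divg (fun y => q y • (𝒯 q y + a y)) x

/-- The pairs `(q(·), α(·))` over which the MFG-2 cost is minimized: positive classical
solutions of `∂_s q + ∇·[(𝒯q + α) q] = DΔq` on `[t,T] × 𝕋^d` with `q_t = q₀`. -/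
structure IsAdmissible {d : ℕ} (𝒯 : TorusC d 2 ℝ →L[ℝ] TorusC d 1 (Space d)) (D t T : ℝ)
    (q₀ : TorusC d 2 ℝ) (q : ℝ → TorusC d 2 ℝ) (α : ℝ → TorusC d 1 (Space d)) : Prop where
  state_continuous : ContinuousOn q (Icc t T)
  control_continuous : ContinuousOn α (Icc t T)
  state_pos : ∀ s ∈ Icc t T, Pos (q s)
  initial : q t = q₀
  continuity : ∀ s ∈ Icc t T, ∀ x,
    HasDerivWithinAt (fun r => q r x) (continuityRHS 𝒯 D (q s) (α s) x) (Icc t T) s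

/-- The MFG-2 cost `𝒢(q_T) + ∫_t^T [∫ L(α_s) q_s dx + ℱ(q_s)] ds`. -/
def cost {d : ℕ} (L : Space d → ℝ) (ℱ 𝒢 : TorusC d 2 ℝ → ℝ) (t T : ℝ)
    (q : ℝ → TorusC d 2 ℝ) (α : ℝ → TorusC d 1 (Space d)) : ℝ :=
  𝒢 (q T) + ∫ s in t..T, (torusInt (fun x => L (α s x) * q s x) + ℱ (q s))

/-- `(q, α)` is an optimal pair of the MFG-2 problem. -/
def IsOptimal {d : ℕ} (𝒯 : TorusC d 2 ℝ →L[ℝ] TorusC d 1 (Space d)) (D t T : ℝ)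
    (L : Space d → ℝ) (ℱ 𝒢 : TorusC d 2 ℝ → ℝ) (q₀ : TorusC d 2 ℝ)
    (q : ℝ → TorusC d 2 ℝ) (α : ℝ → TorusC d 1 (Space d)) : Prop :=
  IsAdmissible 𝒯 D t T q₀ q α ∧
    ∀ q' α', IsAdmissible 𝒯 D t T q₀ q' α' → cost L ℱ 𝒢 t T q α ≤ cost L ℱ 𝒢 t T q' α'

/-- `(q, φ)` is a classical solution on `[t,T] × 𝕋^d` of the MFG-2 system with initial state `q₀`;
`Tadj` stands for the adjoint `𝒯*`. -/
structure SolvesMFG2 {d : ℕ} (𝒯 : TorusC d 2 ℝ →L[ℝ] TorusC d 1 (Space d))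
    (Tadj : TorusC d 1 (Space d) →L[ℝ] TorusC d 0 ℝ) (D t T : ℝ)
    (F G : TorusC d 2 ℝ → TorusC d 0 ℝ) (q₀ : TorusC d 2 ℝ)
    (q φ : ℝ → TorusC d 2 ℝ) : Prop where
  state_continuous : ContinuousOn q (Icc t T)
  adjoint_continuous : ContinuousOn φ (Icc t T)
  forward : ∀ s ∈ Icc t T, ∀ x,
    HasDerivWithinAt (fun r => q r x) (continuityRHS 𝒯 D (q s) (grad (φ s)) x) (Icc t T) s
  initial : q t = q₀
  backward : ∀ s ∈ Icc t T, ∀ x, ∃ φ' : ℝ,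
    HasDerivWithinAt (fun r => φ r x) φ' (Icc t T) s ∧
    φ' + 1 / 2 * ‖grad (φ s) x‖ ^ 2 + inner ℝ (grad (φ s) x) (𝒯 (q s) x)
      + Tadj (mulField (q s) (grad (φ s))) x + D * (Δ (φ s : Space d → ℝ)) x = F (q s) x
  terminal : ∀ x, φ T x = -G (q T) x

end MFG

end

/-! The continuity equation is linear in the pair (state, total flux), so variations are taken in
these variables rather than in the control. Fix a `C^1` field `ζ` whose divergence `θ` is `C^2`, and
a scalar `X` with `X(t) = 0`, `X' = χ`. The state variation `η = -X θ` and the flux variation `y =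
D∇η + χ ζ` solve `∂_s η = DΔη - ∇·y` identically, because the two diffusion terms cancel.
Competitors are thus explicit and no parabolic or elliptic equation has to be solved
(`IsAdmissible.perturb`). For small `ε` of either sign the state stays positive and the cost is at
most a quadratic in `ε` plus the differentiable part coming from `ℱ` and `𝒢`, with equality at `ε =
0`; optimality then makes the first-order coefficient vanish (`IsOptimal.first_order`).

Define `φ` by integrating the backward equation in time from `φ_T = -G(q_T)`, with `α` written in
place of `∇φ`; at this stage `φ` is only continuous in space. With `A = ∫ α·ζ` and `p = ∫ φ θ`,
integration by parts in space and time turns the first-order condition into `∫ χ (A + p) ds = 0`.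
The choice `χ = A + p` gives `A + p = 0` on `[t,T]` (`IsOptimal.weak_gradient`): `α` is the weak
gradient of `φ`.

A continuous function with a continuous weak gradient is differentiable with that gradient
(`hasFDerivAt_of_weak_gradient`). Since `α_s` is `C^1`, `φ_s` is `C^2`, and replacing `α` by `∇φ` in
the definition of `φ` yields the backward equation. -/

noncomputable section

/-! ### The closed cube and the topology of `C^k(𝕋^d)` -/

namespace MFG

open Filter Topology Metric

/-- The closed cube `[0,1]^d`. -/
def closedCube (d : ℕ) : Set (Space d) := {x | ∀ i, x i ∈ Icc (0 : ℝ) 1}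

theorem isCompact_closedCube (d : ℕ) : IsCompact (closedCube d) := by
  have h : IsCompact (Set.pi univ (fun _ : Fin d => Icc (0 : ℝ) 1)) :=
    isCompact_univ_pi fun _ => isCompact_Icc
  have h' := (EuclideanSpace.equiv (Fin d) ℝ).toHomeomorph.isCompact_preimage.2 h
  convert h' using 1
  ext y
  exact ⟨fun hy i _ => hy i, fun hy i => hy i (mem_univ i)⟩

theorem IsPeriodic.exists_mem_closedCube {d : ℕ} {V : Type*} {f : Space d → V} (hf : IsPeriodic f)
    (x : Space d) : ∃ y ∈ closedCube d, f y = f x := hf.exists_mem_Icc x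

namespace TorusC

variable {d k : ℕ} {V : Type} [NormedAddCommGroup V] [NormedSpace ℝ V]

@[simp] theorem coe_sub (f g : TorusC d k V) : ⇑(f - g) = ⇑f - ⇑g := rfl

theorem continuous_coe (f : TorusC d k V) : Continuous f := f.contDiff.continuous

theorem norm_eq (f : TorusC d k V) : ‖f‖ = ‖jet d k V f‖ := rfl

theorem continuous_jet : Continuous (jet d k V) :=
  continuous_induced_dom

theorem norm_iteratedFDeriv_le (f : TorusC d k V) {j : ℕ} (hj : j ≤ k) (x : Space d) :
    ‖iteratedFDeriv ℝ j f x‖ ≤ ‖f‖ := by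
  have h1 := norm_le_pi_norm (jet d k V f) ⟨j, Nat.lt_succ_iff.2 hj⟩
  exact ((jet d k V f ⟨j, Nat.lt_succ_iff.2 hj⟩).norm_coe_le_norm x).trans h1

theorem norm_apply_le (f : TorusC d k V) (x : Space d) : ‖f x‖ ≤ ‖f‖ := by
  simpa using f.norm_iteratedFDeriv_le (Nat.zero_le k) x

theorem norm_le {f : TorusC d k V} {C : ℝ} (hC : 0 ≤ C)
    (h : ∀ j ≤ k, ∀ x, ‖iteratedFDeriv ℝ j f x‖ ≤ C) : ‖f‖ ≤ C := by
  rw [norm_eq, pi_norm_le_iff_of_nonneg hC]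
  exact fun j => (BoundedContinuousFunction.norm_le hC).2
    fun x => h j (Nat.lt_succ_iff.1 j.2) x

theorem continuous_iteratedFDeriv_eval {j : ℕ} (hj : j ≤ k) :
    Continuous fun p : TorusC d k V × Space d => iteratedFDeriv ℝ j p.1 p.2 := by
  have h : Continuous fun p : TorusC d k V × Space d =>
      jet d k V p.1 ⟨j, Nat.lt_succ_iff.2 hj⟩ p.2 := by
    have h1 : Continuous fun p : TorusC d k V × Space d =>
        jet d k V p.1 ⟨j, Nat.lt_succ_iff.2 hj⟩ :=
      (continuous_apply _).comp (continuous_jet.comp continuous_fst)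
    exact h1.eval continuous_snd
  exact h

theorem continuous_apply_apply :
    Continuous fun p : TorusC d k V × Space d => p.1 p.2 := by
  have h := (ContinuousMultilinearMap.apply ℝ (fun _ : Fin 0 => Space d) V
    (fun i => i.elim0)).continuous.comp
    (continuous_iteratedFDeriv_eval (d := d) (V := V) (Nat.zero_le k))
  exact h

theorem fderiv_eq_iteratedFDeriv_one (f : Space d → V) (x : Space d) :
    fderiv ℝ f x = continuousMultilinearCurryFin1 ℝ (Space d) V (iteratedFDeriv ℝ 1 f x) := by
  ext m
  simp [iteratedFDeriv_one_apply]

theorem continuous_fderiv_apply (hk : 1 ≤ k) :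
    Continuous fun p : TorusC d k V × Space d => fderiv ℝ p.1 p.2 := by
  simp_rw [fderiv_eq_iteratedFDeriv_one]
  exact (continuousMultilinearCurryFin1 ℝ (Space d) V).continuous.comp
    (continuous_iteratedFDeriv_eval hk)

variable {S : Type*} [TopologicalSpace S]

/-- A family of `C^k` functions is continuous in the `C^k` norm as soon as all its derivatives up
to order `k` are jointly continuous. -/
theorem continuous_of_continuous_iteratedFDeriv {f : S → TorusC d k V}
    (h : ∀ j ≤ k, Continuous fun p : S × Space d => iteratedFDeriv ℝ j (f p.1) p.2) :
    Continuous f := by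
  refine continuous_iff_continuousAt.2 fun s₀ => ?_
  rw [ContinuousAt, Metric.tendsto_nhds]
  intro ε hε
  -- By periodicity the supremum over space is one over a compact cube, where joint continuity
  -- becomes uniform closeness.
  have key : ∀ j ≤ k, ∀ᶠ s in 𝓝 s₀, ∀ x ∈ closedCube d,
      ‖iteratedFDeriv ℝ j (f s) x - iteratedFDeriv ℝ j (f s₀) x‖ < ε / 2 := by
    intro j hj
    have hc : Continuous fun p : S × Space d =>
        ‖iteratedFDeriv ℝ j (f p.1) p.2 - iteratedFDeriv ℝ j (f s₀) p.2‖ :=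
      ((h j hj).sub ((h j hj).comp (continuous_const.prodMk continuous_snd))).norm
    refine (isCompact_closedCube d).eventually_forall_of_forall_eventually fun y _ => ?_
    exact hc.continuousAt.eventually (gt_mem_nhds (by simpa using hε))
  have key' : ∀ᶠ s in 𝓝 s₀, ∀ j ∈ Finset.range (k + 1), ∀ x ∈ closedCube d,
      ‖iteratedFDeriv ℝ j (f s) x - iteratedFDeriv ℝ j (f s₀) x‖ < ε / 2 := by
    rw [Filter.eventually_all_finset]
    exact fun j hj => key j (Nat.lt_succ_iff.1 (Finset.mem_range.1 hj))
  filter_upwards [key'] with s hs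
  rw [dist_eq_norm]
  refine (norm_le (half_pos hε).le fun j hj x => ?_).trans_lt (half_lt_self hε)
  obtain ⟨y, hy, hyx⟩ := ((f s - f s₀).isPeriodic.iteratedFDeriv j).exists_mem_closedCube x
  rw [← hyx]
  have hj' : ((j : ℕ) : WithTop ℕ∞) ≤ (k : WithTop ℕ∞) := by exact_mod_cast hj
  have : iteratedFDeriv ℝ j (f s - f s₀ : TorusC d k V) y =
      iteratedFDeriv ℝ j (f s) y - iteratedFDeriv ℝ j (f s₀) y :=
    iteratedFDeriv_sub_apply (((f s).contDiff.of_le hj').contDiffAt)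
      (((f s₀).contDiff.of_le hj').contDiffAt)
  rw [this]
  exact (hs j (Finset.mem_range.2 (Nat.lt_succ_iff.2 hj)) y hy).le

theorem continuous_of_continuous_fderiv {f : S → TorusC d 1 V}
    (h0 : Continuous fun p : S × Space d => f p.1 p.2)
    (h1 : Continuous fun p : S × Space d => fderiv ℝ (f p.1) p.2) : Continuous f := by
  refine continuous_of_continuous_iteratedFDeriv fun j hj => ?_
  interval_cases j
  · simp_rw [iteratedFDeriv_zero_eq_comp]
    exact (continuousMultilinearCurryFin0 ℝ (Space d) V).symm.continuous.comp h0
  · have : ∀ (g : Space d → V) x, iteratedFDeriv ℝ 1 g x =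
        (continuousMultilinearCurryFin1 ℝ (Space d) V).symm (fderiv ℝ g x) := by
      intro g x
      rw [fderiv_eq_iteratedFDeriv_one, LinearIsometryEquiv.symm_apply_apply]
    simp_rw [this]
    exact (continuousMultilinearCurryFin1 ℝ (Space d) V).symm.continuous.comp h1

theorem grad_apply (φ : TorusC d 2 ℝ) (x : Space d) : grad φ x = ∇ φ x := rfl

theorem hasFDerivAt_coe (hk : 1 ≤ k) (f : TorusC d k V) (x : Space d) :
    HasFDerivAt f (fderiv ℝ f x) x :=
  (f.contDiff.differentiable (by
    have : (1 : WithTop ℕ∞) ≤ k := by exact_mod_cast hk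
    intro h; simp [h] at this)).differentiableAt.hasFDerivAt

theorem fderiv_eq_toDual_grad (φ : TorusC d 2 ℝ) (x : Space d) :
    fderiv ℝ φ x = InnerProductSpace.toDual ℝ (Space d) (grad φ x) := by
  rw [grad_apply, gradient, LinearIsometryEquiv.apply_symm_apply]

/-- The Riesz map `v ↦ ⟨v, ·⟩` as a real-linear continuous map. -/
def toDualL (d : ℕ) : Space d →L[ℝ] Space d →L[ℝ] ℝ :=
  LinearMap.toContinuousLinearMap
    { toFun := InnerProductSpace.toDual ℝ (Space d)
      map_add' := fun _ _ => map_add _ _ _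
      map_smul' := fun c v => by simp }

/-- A family of `C^2` functions is continuous in the `C^2` norm as soon as it is jointly continuous
and its gradient is continuous in the `C^1` norm. -/
theorem continuous_of_continuous_grad {f : S → TorusC d 2 ℝ}
    (h0 : Continuous fun p : S × Space d => f p.1 p.2)
    (h1 : Continuous fun s => grad (f s)) : Continuous f := by
  refine continuous_of_continuous_iteratedFDeriv fun j hj => ?_
  rcases j with _ | j
  · simp_rw [iteratedFDeriv_zero_eq_comp]
    exact (continuousMultilinearCurryFin0 ℝ (Space d) ℝ).symm.continuous.comp h0
  · have hj1 : j ≤ 1 := by omega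
    have hj' : ((j : ℕ) : WithTop ℕ∞) ≤ ((1 : ℕ) : WithTop ℕ∞) := by exact_mod_cast hj1
    -- Up to the Riesz map and currying, derivatives of positive order of `f` are derivatives of its
    -- gradient, of order one less.
    have e : ∀ (s : S) (x : Space d), iteratedFDeriv ℝ (j + 1) (f s) x =
        (continuousMultilinearCurryRightEquiv' ℝ j (Space d) ℝ).symm
          ((toDualL d).compContinuousMultilinearMap (iteratedFDeriv ℝ j (grad (f s)) x)) := by
      intro s x
      rw [iteratedFDeriv_succ_eq_comp_right, Function.comp_apply]
      congr 1
      rw [← ContinuousLinearMap.iteratedFDeriv_comp_left _ ((grad (f s)).contDiff.contDiffAt) hj']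
      congr 1
      funext y
      exact fderiv_eq_toDual_grad (f s) y
    simp_rw [e]
    refine (LinearIsometryEquiv.continuous _).comp ?_
    refine (ContinuousLinearMap.compContinuousMultilinearMapL ℝ (fun _ : Fin j => Space d) _ _
      _).continuous.comp ?_
    exact (continuous_iteratedFDeriv_eval hj1).comp ((h1.comp continuous_fst).prodMk continuous_snd)

end TorusC

end MFG

end

/-! ### Integration over the torus -/

noncomputable section

namespace MFG

open Filter Topology Metric
open scoped Pointwise

variable {d : ℕ}

theorem unitCube_eq_fundamentalDomain (d : ℕ) :
    unitCube d = ZSpan.fundamentalDomain (EuclideanSpace.basisFun (Fin d) ℝ).toBasis := by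
  ext x
  simp [unitCube, ZSpan.mem_fundamentalDomain]

theorem unitCube_ae_eq_closedCube (d : ℕ) : unitCube d =ᵐ[volume] closedCube d := by
  rw [unitCube_eq_fundamentalDomain]
  refine (ZSpan.fundamentalDomain_ae_parallelepiped _ volume).trans ?_
  have : parallelepiped (EuclideanSpace.basisFun (Fin d) ℝ).toBasis = closedCube d := by
    ext x
    rw [parallelepiped_basis_eq]
    simp [closedCube]
  exact Filter.EventuallyEq.of_eq this

/-- The half-open cube is a fundamental domain of the lattice and supplies translation invariance;
the closed one is compact and supplies integrability and uniform bounds. They differ by a null set.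
-/
theorem torusInt_eq (f : Space d → ℝ) : torusInt f = ∫ x in closedCube d, f x :=
  setIntegral_congr_set (unitCube_ae_eq_closedCube d)

theorem volume_closedCube (d : ℕ) : volume (closedCube d) = 1 := by
  rw [← measure_congr (unitCube_ae_eq_closedCube d), unitCube_eq_fundamentalDomain,
    measure_congr (ZSpan.fundamentalDomain_ae_parallelepiped _ volume)]
  simpa using (EuclideanSpace.basisFun (Fin d) ℝ).volume_parallelepiped

theorem integrableOn_closedCube {f : Space d → ℝ} (hf : Continuous f) :
    IntegrableOn f (closedCube d) :=
  hf.continuousOn.integrableOn_compact (isCompact_closedCube d)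

theorem torusInt_add {f g : Space d → ℝ} (hf : Continuous f) (hg : Continuous g) :
    torusInt (fun x => f x + g x) = torusInt f + torusInt g := by
  simp only [torusInt_eq]
  exact integral_add (integrableOn_closedCube hf) (integrableOn_closedCube hg)

theorem torusInt_sub {f g : Space d → ℝ} (hf : Continuous f) (hg : Continuous g) :
    torusInt (fun x => f x - g x) = torusInt f - torusInt g := by
  simp only [torusInt_eq]
  exact integral_sub (integrableOn_closedCube hf) (integrableOn_closedCube hg)

theorem torusInt_neg (f : Space d → ℝ) : torusInt (fun x => -f x) = -torusInt f :=
  integral_neg _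

theorem torusInt_const_mul (c : ℝ) (f : Space d → ℝ) :
    torusInt (fun x => c * f x) = c * torusInt f :=
  integral_const_mul _ _

theorem torusInt_sum {ι : Type*} (s : Finset ι) {f : ι → Space d → ℝ}
    (hf : ∀ i ∈ s, Continuous (f i)) :
    torusInt (fun x => ∑ i ∈ s, f i x) = ∑ i ∈ s, torusInt (f i) := by
  simp only [torusInt_eq]
  exact integral_finsetSum _ fun i hi => integrableOn_closedCube (hf i hi)

theorem torusInt_mono {f g : Space d → ℝ} (hf : Continuous f) (hg : Continuous g)
    (h : ∀ x, f x ≤ g x) : torusInt f ≤ torusInt g := by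
  simp only [torusInt_eq]
  exact integral_mono (integrableOn_closedCube hf) (integrableOn_closedCube hg) h

theorem abs_torusInt_le {f : Space d → ℝ} {C : ℝ} (h : ∀ x, |f x| ≤ C) : |torusInt f| ≤ C := by
  rw [torusInt_eq]
  have := norm_setIntegral_le_of_norm_le_const (μ := volume) (s := closedCube d) (f := f)
    (by simp [volume_closedCube]) (fun x _ => h x)
  simpa [Measure.real, volume_closedCube] using this

theorem continuous_torusInt {S : Type*} [TopologicalSpace S] [FirstCountableTopology S]
    [LocallyCompactSpace S] {f : S → Space d → ℝ}
    (hf : Continuous fun p : S × Space d => f p.1 p.2) : Continuous fun s => torusInt (f s) := by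
  simp only [torusInt_eq]
  exact continuous_parametric_integral_of_continuous (f := f) hf (isCompact_closedCube d)

theorem IsPeriodic.vadd_eq {V : Type*} {f : Space d → V} (hf : IsPeriodic f)
    (g : (Submodule.span ℤ (range (EuclideanSpace.basisFun (Fin d) ℝ).toBasis)).toAddSubgroup)
    (x : Space d) :
    f (g +ᵥ x) = f x := by
  obtain ⟨g, hg⟩ := g
  change f (g + x) = f x
  induction hg using Submodule.span_induction generalizing x with
  | mem y hy =>
    obtain ⟨i, rfl⟩ := hy
    rw [add_comm]
    simpa using hf x i
  | zero => simp
  | add y z _ _ hy hz => rw [add_assoc, hy, hz]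
  | smul n y _ hy =>
    induction n using Int.induction_on generalizing x with
    | zero => simp
    | succ n ih => rw [add_smul, one_smul, add_assoc, ih, hy]
    | pred n ih =>
      rw [sub_smul, one_smul, ← hy (-(n : ℤ) • y - y + x)]
      rw [show y + (-(n : ℤ) • y - y + x) = -(n : ℤ) • y + x by abel, ih]

/-- The cube shifted by `v` is another fundamental domain of the same lattice, and a
lattice-invariant function has the same integral over both. -/
theorem torusInt_translate {f : Space d → ℝ} (hf : IsPeriodic f) (v : Space d) :
    torusInt (fun x => f (x + v)) = torusInt f := by
  have h1 := ZSpan.isAddFundamentalDomain' (EuclideanSpace.basisFun (Fin d) ℝ).toBasis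
    (volume : Measure (Space d))
  have h2 : IsAddFundamentalDomain
      (Submodule.span ℤ (range (EuclideanSpace.basisFun (Fin d) ℝ).toBasis)).toAddSubgroup
      (v +ᵥ ZSpan.fundamentalDomain (EuclideanSpace.basisFun (Fin d) ℝ).toBasis)
      (volume : Measure (Space d)) := h1.vadd_of_comm v
  have : Countable (Submodule.span ℤ
      (range (EuclideanSpace.basisFun (Fin d) ℝ).toBasis)).toAddSubgroup :=
    inferInstanceAs (Countable (Submodule.span ℤ
      (range (EuclideanSpace.basisFun (Fin d) ℝ).toBasis)))
  have h3 := h1.setIntegral_eq h2 (f := f) hf.vadd_eq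
  unfold torusInt
  rw [unitCube_eq_fundamentalDomain, h3]
  have h4 := (measurePreserving_add_left (volume : Measure (Space d)) v).setIntegral_image_emb
    (measurableEmbedding_addLeft v) f
    (ZSpan.fundamentalDomain (EuclideanSpace.basisFun (Fin d) ℝ).toBasis)
  simp_rw [add_comm _ v]
  exact h4.symm

/-- Differentiation under the torus integral. -/
theorem hasDerivAt_torusInt {f f' : ℝ → Space d → ℝ} (hf : ∀ s, Continuous (f s))
    (hf' : Continuous fun p : ℝ × Space d => f' p.1 p.2)
    (hd : ∀ s x, HasDerivAt (fun r => f r x) (f' s x) s) (s : ℝ) :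
    HasDerivAt (fun r => torusInt (f r)) (torusInt (f' s)) s := by
  simp only [torusInt_eq]
  obtain ⟨C, hC⟩ := ((isCompact_Icc (a := s - 1) (b := s + 1)).prod
    (isCompact_closedCube d)).exists_bound_of_continuousOn hf'.continuousOn
  have hs : ∀ r, Continuous (f' r) := fun r => hf'.comp (by fun_prop : Continuous fun x => (r, x))
  refine (hasDerivAt_integral_of_dominated_loc_of_deriv_le (bound := fun _ => C)
    (Icc_mem_nhds (sub_one_lt s) (lt_add_one s))
    (Eventually.of_forall fun r => (hf r).aestronglyMeasurable) (integrableOn_closedCube (hf s))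
    (hs s).aestronglyMeasurable ?_ (integrableOn_closedCube continuous_const)
    (Eventually.of_forall fun x r _ => hd r x)).2
  exact ae_restrict_of_forall_mem (isCompact_closedCube d).measurableSet
    fun x hx r hr => hC (r, x) ⟨hr, hx⟩

theorem IsPeriodic.fderiv {V : Type*} [NormedAddCommGroup V] [NormedSpace ℝ V] {f : Space d → V}
    (hf : IsPeriodic f) : IsPeriodic (fderiv ℝ f) := by
  intro x i
  rw [← fderiv_comp_add_right]
  congr 1
  funext y
  exact hf y i

theorem IsPeriodic.comp_add_right {V : Type*} {f : Space d → V} (hf : IsPeriodic f) (v : Space d) :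
    IsPeriodic fun x => f (x + v) := by
  intro x i
  simp only [add_right_comm x _ v]
  exact hf (x + v) i

theorem IsPeriodic.mul {f g : Space d → ℝ} (hf : IsPeriodic f) (hg : IsPeriodic g) :
    IsPeriodic fun x => f x * g x := by
  intro x i
  simp only [hf x i, hg x i]

theorem hasDerivAt_apply_add_smul {V : Type*} [NormedAddCommGroup V] [NormedSpace ℝ V]
    {f : Space d → V} (hf : ContDiff ℝ 1 f) (x v : Space d) (s : ℝ) :
    HasDerivAt (fun r : ℝ => f (x + r • v)) (fderiv ℝ f (x + s • v) v) s := by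
  have h1 : HasDerivAt (fun r : ℝ => x + r • v) v s := by
    simpa using ((hasDerivAt_id s).smul_const v).const_add x
  exact ((hf.differentiable one_ne_zero) (x + s • v)).hasFDerivAt.comp_hasDerivAt s h1

/-- The integral of `f(· + s v)` does not depend on `s`; differentiating at `s = 0` gives the claim
without Fubini or boundary terms. -/
theorem torusInt_fderiv_apply {f : Space d → ℝ} (hf : ContDiff ℝ 1 f) (hp : IsPeriodic f)
    (v : Space d) : torusInt (fun x => fderiv ℝ f x v) = 0 := by
  have hc : Continuous (fderiv ℝ f) := hf.continuous_fderiv one_ne_zero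
  have h := hasDerivAt_torusInt (f := fun s x => f (x + s • v))
    (f' := fun s x => fderiv ℝ f (x + s • v) v)
    (fun s => hf.continuous.comp (by fun_prop)) (by fun_prop)
    (fun s x => hasDerivAt_apply_add_smul hf x v s) 0
  simp only [torusInt_translate hp, zero_smul, add_zero] at h
  exact h.unique (hasDerivAt_const _ _)

/-! ### Weak derivatives of continuous periodic functions -/

/-- A peak function on the torus: it attains its maximum exactly at the centre of the cube. -/
def peak (d : ℕ) (x : Space d) : ℝ := 1 + ∑ i, Real.sin (Real.pi * x i) ^ 2

theorem contDiff_peak {n : WithTop ℕ∞} : ContDiff ℝ n (peak d) := by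
  unfold peak
  fun_prop

theorem isPeriodic_peak : IsPeriodic (peak d) := by
  intro x i
  unfold peak
  congr 1
  refine Finset.sum_congr rfl fun j _ => ?_
  by_cases h : j = i
  · subst h
    simp [mul_add, Real.sin_add_pi]
  · simp [h]

/-- A continuous periodic function vanishes if its integral against every smooth periodic test
function does. -/
theorem eq_zero_of_forall_torusInt_mul_eq_zero {f : Space d → ℝ} (hf : Continuous f)
    (hp : IsPeriodic f)
    (h : ∀ ψ : Space d → ℝ, ContDiff ℝ 3 ψ → IsPeriodic ψ → torusInt (fun x => f x * ψ x) = 0)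
    (a : Space d) : f a = 0 := by
  set c : Space d := WithLp.toLp 2 fun _ => 1 / 2 with hc
  have hci : ∀ i, c i = 1 / 2 := fun _ => rfl
  have hint : c ∈ interior (closedCube d) := by
    rw [mem_interior]
    refine ⟨{x | ∀ i, x i ∈ Ioo (0 : ℝ) 1}, fun x hx i => Ioo_subset_Icc_self (hx i), ?_, ?_⟩
    · simp only [ofPred_forall]
      exact isOpen_iInter_of_finite fun i => isOpen_Ioo.preimage (by fun_prop)
    · intro i
      rw [hci]
      norm_num
  have hlt : ∀ y ∈ closedCube d, y ≠ c → peak d y < peak d c := by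
    intro y hy hyc
    obtain ⟨i, hi⟩ : ∃ i, y i ≠ c i := by
      by_contra! hcon
      exact hyc (PiLp.ext hcon)
    have hle : ∀ j, Real.sin (Real.pi * y j) ^ 2 ≤ Real.sin (Real.pi * c j) ^ 2 := by
      intro j
      rw [hci, mul_one_div, Real.sin_pi_div_two, one_pow]
      exact Real.sin_sq_le_one _
    unfold peak
    refine (add_lt_add_iff_left 1).2 (Finset.sum_lt_sum (fun j _ => hle j) ⟨i, Finset.mem_univ i, ?_⟩)
    rw [hci] at hi ⊢
    rw [mul_one_div, Real.sin_pi_div_two, one_pow]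
    refine lt_of_le_of_ne (Real.sin_sq_le_one _) fun hs => hi ?_
    have hcos : Real.cos (Real.pi * y i) = Real.cos (Real.pi / 2) := by
      rw [Real.cos_pi_div_two]
      have := Real.sin_sq_add_cos_sq (Real.pi * y i)
      nlinarith
    have := Real.injOn_cos ⟨by have := (hy i).1; positivity,
      by nlinarith [(hy i).2, Real.pi_pos]⟩ ⟨by positivity, by linarith [Real.pi_pos]⟩ hcos
    field_simp at this
    linarith
  have hpos : ∀ x, 0 < peak d x := fun x => by unfold peak; positivity
  have hg : Continuous fun x => f (x + (a - c)) := hf.comp (by fun_prop)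
  -- The normalized powers of `peak` concentrate at the centre `c`, so the averages of `f(· + (a -
  -- c))` against them tend to `f a`. Translated back, each power is a smooth periodic test
  -- function, so every average is zero.
  have hlim := tendsto_setIntegral_pow_smul_of_unique_maximum_of_isCompact_of_continuousOn
    (μ := volume) (isCompact_closedCube d) (contDiff_peak (n := 0)).continuous.continuousOn hlt
    (fun x _ => (hpos x).le) (hpos c) (subset_closure hint) hg.continuousOn
  have hzero : ∀ n : ℕ, ∫ x in closedCube d, peak d x ^ n • f (x + (a - c)) = 0 := by
    intro n
    rw [← torusInt_eq]
    have h1 := h (fun x => peak d (x - (a - c)) ^ n)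
      ((contDiff_peak.comp (contDiff_id.sub contDiff_const)).pow n) (by
        intro x i
        have := isPeriodic_peak.comp_add_right (-(a - c)) x i
        simp only [← sub_eq_add_neg] at this
        simp only [this])
    rw [← torusInt_translate (hp.mul (by
        intro x i
        have := isPeriodic_peak.comp_add_right (-(a - c)) x i
        simp only [← sub_eq_add_neg] at this
        simp only [this])) (a - c)] at h1
    rw [← h1]
    congr 1
    funext x
    rw [add_sub_cancel_right, smul_eq_mul, mul_comm]
  simp only [hzero, smul_zero, add_sub_cancel] at hlim
  exact tendsto_nhds_unique hlim tendsto_const_nhds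

/-- If `a` is the weak derivative of `φ` in direction `v`, then `φ` is recovered along `v` by
integrating `a`. -/
theorem sub_eq_integral_of_weak_deriv {φ a : Space d → ℝ} {v : Space d} (hφ : Continuous φ)
    (hφp : IsPeriodic φ) (ha : Continuous a) (hap : IsPeriodic a)
    (hw : ∀ ψ : Space d → ℝ, ContDiff ℝ 3 ψ → IsPeriodic ψ →
      torusInt (fun x => a x * ψ x) = -torusInt (fun x => φ x * fderiv ℝ ψ x v)) (x : Space d) :
    φ (x + v) - φ x = ∫ s in (0 : ℝ)..1, a (x + s • v) := by
  set H : ℝ → Space d → ℝ := fun r x => ∫ s in (0 : ℝ)..r, a (x + s • v) with hH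
  have hac : ∀ x : Space d, Continuous fun s : ℝ => a (x + s • v) := fun x => ha.comp (by fun_prop)
  have hHc : ∀ r, Continuous (H r) := fun r =>
    intervalIntegral.continuous_parametric_intervalIntegral_of_continuous'
      (f := fun x s => a (x + s • v)) (ha.comp (by fun_prop)) 0 r
  have hHd : ∀ r x, HasDerivAt (fun r => H r x) (a (x + r • v)) r := fun r x =>
    intervalIntegral.integral_hasDerivAt_right ((hac x).intervalIntegrable _ _)
      ((hac x).stronglyMeasurableAtFilter _ _) (hac x).continuousAt
  have hHp : IsPeriodic (H 1) := by
    intro x i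
    simp only [hH]
    congr 1
    funext s
    rw [add_right_comm]
    exact hap _ i
  have hmain : ∀ y, φ (y + v) - φ y - H 1 y = 0 := by
    refine eq_zero_of_forall_torusInt_mul_eq_zero (((hφ.comp (by fun_prop)).sub hφ).sub (hHc 1))
      (fun y i => ?_) fun ψ hψ hψp => ?_
    · rw [hHp y i, hφp y i, add_right_comm, hφp (y + v) i]
    have hψ1 : ContDiff ℝ 1 ψ := hψ.of_le (by norm_num)
    have hψc : Continuous ψ := hψ.continuous
    have hψ' : Continuous (fderiv ℝ ψ) := hψ1.continuous_fderiv one_ne_zero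
    -- Translation moves the shift onto the smooth factor, so the integral is differentiable in `r`
    -- although `φ` is only continuous.
    have e1 : ∀ r : ℝ, torusInt (fun x => φ (x + r • v) * ψ x) =
        torusInt (fun x => φ x * ψ (x + r • -v)) := by
      intro r
      rw [← torusInt_translate (hφp.mul (hψp.comp_add_right (r • -v))) (r • v)]
      congr 1
      funext y
      simp
    have d1 : ∀ r : ℝ, HasDerivAt (fun r => torusInt (fun x => φ (x + r • v) * ψ x))
        (torusInt fun x => a (x + r • v) * ψ x) r := by
      intro r
      simp only [e1]
      have h1 := hasDerivAt_torusInt (f := fun r x => φ x * ψ (x + r • -v))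
        (f' := fun r x => φ x * fderiv ℝ ψ (x + r • -v) (-v)) (fun r => by fun_prop)
        (by fun_prop) (fun r x => (hasDerivAt_apply_add_smul hψ1 x (-v) r).const_mul _) r
      convert h1 using 1
      have h2 := hw (fun x => ψ (x + r • -v)) (hψ.comp (by fun_prop)) (hψp.comp_add_right _)
      simp only [fderiv_comp_add_right] at h2
      simp only [map_neg, mul_neg, torusInt_neg] at h2 ⊢
      rw [← h2, ← torusInt_translate (hap.mul ((hψp.comp_add_right (r • -v)))) (r • v)]
      congr 1
      funext y
      simp
    have d2 : ∀ r : ℝ, HasDerivAt (fun r => torusInt (fun x => H r x * ψ x))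
        (torusInt fun x => a (x + r • v) * ψ x) r := fun r =>
      hasDerivAt_torusInt (f := fun r x => H r x * ψ x) (f' := fun r x => a (x + r • v) * ψ x)
        (fun r => (hHc r).mul hψc) (by fun_prop) (fun r x => (hHd r x).mul_const _) r
    -- Tested against `ψ`, the shifted function `φ(· + r v)` and the line integral `H r` have the
    -- same `r`-derivative. Comparing `r = 1` with `r = 0` gives the identity in weak form.
    have h3 := is_const_of_deriv_eq_zero
      (f := fun r => torusInt (fun x => φ (x + r • v) * ψ x) - torusInt (fun x => H r x * ψ x))
      (fun r => ((d1 r).sub (d2 r)).differentiableAt)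
      (fun r => ((d1 r).sub (d2 r)).deriv.trans (sub_self _)) 1 0
    have h4 : H 0 = 0 := by
      funext y
      simp [hH]
    simp only [h4, one_smul, zero_smul, add_zero, Pi.zero_apply, zero_mul] at h3
    simp only [sub_mul]
    have hφv : Continuous fun x => φ (x + v) * ψ x := by fun_prop
    have hz : torusInt (fun _ : Space d => (0 : ℝ)) = 0 := by simp [torusInt]
    have hHψ : Continuous fun x => H 1 x * ψ x := (hHc 1).mul hψc
    have hφψ : Continuous fun x => φ x * ψ x := hφ.mul hψc
    have hdiff : Continuous fun x => φ (x + v) * ψ x - φ x * ψ x := hφv.sub hφψ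
    rw [torusInt_sub hdiff hHψ, torusInt_sub hφv hφψ]
    linarith
  exact sub_eq_zero.1 (hmain x)

/-- A continuous periodic function with a continuous weak gradient is differentiable. -/
theorem hasFDerivAt_of_weak_gradient {φ : Space d → ℝ} {α : Space d → Space d} (hφ : Continuous φ)
    (hφp : IsPeriodic φ) (hα : Continuous α) (hαp : IsPeriodic α)
    (hw : ∀ (v : Space d) (ψ : Space d → ℝ), ContDiff ℝ 3 ψ → IsPeriodic ψ →
      torusInt (fun x => inner ℝ (α x) v * ψ x) = -torusInt (fun x => φ x * fderiv ℝ ψ x v))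
    (x : Space d) : HasFDerivAt φ (InnerProductSpace.toDual ℝ (Space d) (α x)) x := by
  rw [hasFDerivAt_iff_isLittleO_nhds_zero, Asymptotics.isLittleO_iff]
  intro ε hε
  obtain ⟨δ, hδ, hαδ⟩ := Metric.continuousAt_iff.1 (hα.continuousAt (x := x)) ε hε
  filter_upwards [Metric.ball_mem_nhds (0 : Space d) hδ] with v hv
  rw [mem_ball_zero_iff] at hv
  have hc : Continuous fun s : ℝ => inner ℝ (α (x + s • v)) v := by fun_prop
  have h1 : φ (x + v) - φ x = ∫ s in (0 : ℝ)..1, inner ℝ (α (x + s • v)) v :=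
    sub_eq_integral_of_weak_deriv (a := fun y => inner ℝ (α y) v) hφ hφp (by fun_prop)
    (fun y i => by simp only [hαp y i]) (hw v) x
  -- The Taylor remainder is an average of increments of `α` along the segment, hence at most `ε *
  -- ‖v‖` by continuity of `α` at `x`.
  have h2 : φ (x + v) - φ x - InnerProductSpace.toDual ℝ (Space d) (α x) v =
      ∫ s in (0 : ℝ)..1, inner ℝ (α (x + s • v) - α x) v := by
    simp only [inner_sub_left]
    rw [intervalIntegral.integral_sub (hc.intervalIntegrable _ _) (by simp), h1]
    simp
  rw [h2]
  refine (intervalIntegral.norm_integral_le_of_norm_le_const (C := ε * ‖v‖) fun s hs => ?_).trans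
    (by simp)
  rw [uIoc_of_le zero_le_one] at hs
  refine (norm_inner_le_norm _ _).trans ?_
  gcongr
  rw [← dist_eq_norm]
  refine (hαδ ?_).le
  rw [dist_eq_norm, add_sub_cancel_left, norm_smul, Real.norm_eq_abs, abs_of_pos hs.1]
  nlinarith [norm_nonneg v, hs.2]

end MFG

end

/-! ### Divergence, gradient, and products and quotients of fields -/

noncomputable section

namespace MFG

open Filter Topology Metric

variable {d : ℕ}

open TorusC

theorem divg_add {v w : Space d → Space d} {x : Space d} (hv : DifferentiableAt ℝ v x)
    (hw : DifferentiableAt ℝ w x) : divg (fun y => v y + w y) x = divg v x + divg w x := by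
  simp [divg, fderiv_fun_add hv hw, Finset.sum_add_distrib]

theorem divg_const_smul (c : ℝ) (v : Space d → Space d) (x : Space d) :
    divg (fun y => c • v y) x = c * divg v x := by
  have : fderiv ℝ (fun y => c • v y) x = c • fderiv ℝ v x := by
    exact congrFun (fderiv_const_smul_field (f := v) c) x
  simp [divg, this, Finset.mul_sum]

theorem divg_smul {θ : Space d → ℝ} {v : Space d → Space d} {x : Space d}
    (hθ : DifferentiableAt ℝ θ x) (hv : DifferentiableAt ℝ v x) :
    divg (fun y => θ y • v y) x = θ x * divg v x + fderiv ℝ θ x (v x) := by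
  have h1 : fderiv ℝ θ x (v x) =
      ∑ i, fderiv ℝ θ x (EuclideanSpace.single i 1) * v x i := by
    conv_lhs => rw [← (EuclideanSpace.basisFun (Fin d) ℝ).sum_repr (v x)]
    simp [mul_comm]
  rw [h1]
  simp [divg, fderiv_fun_smul hθ hv, Finset.sum_add_distrib, Finset.mul_sum]

theorem torusInt_divg {v : Space d → Space d} (hv : ContDiff ℝ 1 v) (hp : IsPeriodic v) :
    torusInt (divg v) = 0 := by
  have hvi : ∀ i, ContDiff ℝ 1 fun x => v x i := fun i => (contDiff_euclidean.1 hv) i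
  have h1 : ∀ x, divg v x =
      ∑ i, fderiv ℝ (fun y => v y i) x (EuclideanSpace.single i 1) := by
    intro x
    refine Finset.sum_congr rfl fun i _ => ?_
    have : fderiv ℝ (fun y => v y i) x =
        (EuclideanSpace.proj i : Space d →L[ℝ] ℝ).comp (fderiv ℝ v x) :=
      ((EuclideanSpace.proj i : Space d →L[ℝ] ℝ).hasFDerivAt.comp x
        ((hv.differentiable one_ne_zero) x).hasFDerivAt).fderiv
    rw [this]
    rfl
  have h2 : divg v = fun x => ∑ i, fderiv ℝ (fun y => v y i) x (EuclideanSpace.single i 1) :=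
    funext h1
  rw [h2, torusInt_sum]
  · refine Finset.sum_eq_zero fun i _ => torusInt_fderiv_apply (hvi i) (fun x j => ?_) _
    simp only [hp x j]
  · intro i _
    exact ((hvi i).continuous_fderiv one_ne_zero).clm_apply continuous_const

namespace TorusC

variable {k : ℕ} {V : Type} [NormedAddCommGroup V] [NormedSpace ℝ V]

theorem differentiableAt_coe (hk : 1 ≤ k) (f : TorusC d k V) (x : Space d) :
    DifferentiableAt ℝ f x := (f.hasFDerivAt_coe hk x).differentiableAt

theorem divg_coe_add (v w : TorusC d 1 (Space d)) (x : Space d) :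
    divg ⇑(v + w) x = divg v x + divg w x :=
  divg_add (v.differentiableAt_coe le_rfl x) (w.differentiableAt_coe le_rfl x)

theorem divg_coe_smul (c : ℝ) (v : TorusC d 1 (Space d)) (x : Space d) :
    divg ⇑(c • v) x = c * divg v x := divg_const_smul c v x

theorem laplacian_coe_add (f g : TorusC d 2 ℝ) (x : Space d) :
    (Δ ⇑(f + g)) x = (Δ ⇑f) x + (Δ ⇑g) x :=
  f.contDiff.contDiffAt.laplacian_add g.contDiff.contDiffAt

theorem laplacian_coe_smul (c : ℝ) (f : TorusC d 2 ℝ) (x : Space d) :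
    (Δ ⇑(c • f)) x = c * (Δ ⇑f) x :=
  InnerProductSpace.laplacian_smul c f.contDiff.contDiffAt

theorem inner_grad (φ : TorusC d 2 ℝ) (x v : Space d) :
    inner ℝ (grad φ x) v = fderiv ℝ φ x v := by
  rw [fderiv_eq_toDual_grad, InnerProductSpace.toDual_apply_apply]

theorem divg_grad (φ : TorusC d 2 ℝ) (x : Space d) : divg (grad φ) x = (Δ ⇑φ) x := by
  rw [InnerProductSpace.laplacian_eq_iteratedFDeriv_orthonormalBasis φ
    (EuclideanSpace.basisFun (Fin d) ℝ)]
  refine Finset.sum_congr rfl fun i _ => ?_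
  have h1 : fderiv ℝ φ = toDualL d ∘ grad φ := funext fun y => fderiv_eq_toDual_grad φ y
  have h2 : fderiv ℝ (fderiv ℝ φ) x = (toDualL d).comp (fderiv ℝ (grad φ) x) := by
    rw [h1]
    exact ((toDualL d).hasFDerivAt.comp x ((grad φ).hasFDerivAt_coe le_rfl x)).fderiv
  rw [iteratedFDeriv_two_apply, h2]
  simp [toDualL, EuclideanSpace.inner_single_right]

theorem continuous_divg_apply :
    Continuous fun p : TorusC d 1 (Space d) × Space d => divg p.1 p.2 := by
  unfold divg
  refine continuous_finsetSum _ fun i _ => ?_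
  have h : Continuous fun p : TorusC d 1 (Space d) × Space d =>
      fderiv ℝ p.1 p.2 (EuclideanSpace.single i 1) :=
    (continuous_fderiv_apply le_rfl).clm_apply continuous_const
  fun_prop

/-- Integration by parts on the torus. -/
theorem torusInt_inner_grad (θ : TorusC d 2 ℝ) (v : TorusC d 1 (Space d)) :
    torusInt (fun x => inner ℝ (v x) (grad θ x)) = -torusInt (fun x => divg v x * θ x) := by
  have h1 : ∀ x, divg (mulField θ v) x = divg v x * θ x + inner ℝ (v x) (grad θ x) := by
    intro x
    rw [real_inner_comm, inner_grad, mul_comm]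
    exact divg_smul (θ.differentiableAt_coe one_le_two x) (v.differentiableAt_coe le_rfl x)
  have h2 := torusInt_divg (mulField θ v).contDiff (mulField θ v).isPeriodic
  have h3 : divg (mulField θ v) = fun x => divg v x * θ x + inner ℝ (v x) (grad θ x) := funext h1
  have hdc : Continuous (divg v) :=
    continuous_divg_apply.comp (by fun_prop : Continuous fun x => (v, x))
  have hdθ : Continuous fun x => divg v x * θ x := hdc.mul θ.continuous_coe
  rw [h3, torusInt_add hdθ (v.continuous_coe.inner (grad θ).continuous_coe)] at h2
  linarith

@[simp] theorem mulField_apply (q : TorusC d 2 ℝ) (v : TorusC d 1 (Space d)) (x : Space d) :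
    mulField q v x = q x • v x := rfl

variable {S : Type*} [TopologicalSpace S]

theorem _root_.Continuous.torusC_apply {f : S → TorusC d k V} (hf : Continuous f) :
    Continuous fun p : S × Space d => f p.1 p.2 :=
  continuous_apply_apply.comp ((hf.comp continuous_fst).prodMk continuous_snd)

theorem _root_.Continuous.torusC_fderiv (hk : 1 ≤ k) {f : S → TorusC d k V} (hf : Continuous f) :
    Continuous fun p : S × Space d => fderiv ℝ (f p.1) p.2 :=
  (continuous_fderiv_apply hk).comp ((hf.comp continuous_fst).prodMk continuous_snd)

theorem _root_.Continuous.mulField {f : S → TorusC d 2 ℝ} {g : S → TorusC d 1 (Space d)}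
    (hf : Continuous f) (hg : Continuous g) : Continuous fun s => mulField (f s) (g s) := by
  have hfc := hf.torusC_apply
  have hgc := hg.torusC_apply
  refine continuous_of_continuous_fderiv (hfc.smul hgc) ?_
  have h : ∀ p : S × Space d, fderiv ℝ (TorusC.mulField (f p.1) (g p.1)) p.2 =
      f p.1 p.2 • fderiv ℝ (g p.1) p.2 +
        (fderiv ℝ (f p.1) p.2).smulRight (g p.1 p.2) := fun p =>
    fderiv_fun_smul ((f p.1).differentiableAt_coe one_le_two p.2)
      ((g p.1).differentiableAt_coe le_rfl p.2)
  simp_rw [h]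
  exact (hfc.smul (hg.torusC_fderiv le_rfl)).add
    ((ContinuousLinearMap.smulRightL ℝ (Space d) (Space d)).continuous₂.comp₂
      (hf.torusC_fderiv one_le_two) hgc)

open Classical in
/-- The quotient `v / q ∈ C^1(𝕋^d; ℝ^d)` of `v ∈ C^1(𝕋^d; ℝ^d)` by a positive `q ∈ C^2(𝕋^d)`. -/
def divField (q : TorusC d 2 ℝ) (v : TorusC d 1 (Space d)) : TorusC d 1 (Space d) :=
  if h : Pos q then
    ⟨fun x => (q x)⁻¹ • v x,
      ((q.contDiff.of_le (by norm_num)).inv fun x => (h x).ne').smul v.contDiff,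
      fun x i => by simp only [q.isPeriodic x i, v.isPeriodic x i]⟩
  -- A default that makes the quotient total; every lemma describing it assumes `Pos q`.
  else 0

theorem coe_divField {q : TorusC d 2 ℝ} (hq : Pos q) (v : TorusC d 1 (Space d)) :
    ⇑(divField q v) = fun x => (q x)⁻¹ • v x := by
  have h : divField q v = _ := dif_pos hq
  rw [h]
  rfl

theorem divField_apply {q : TorusC d 2 ℝ} (hq : Pos q) (v : TorusC d 1 (Space d)) (x : Space d) :
    divField q v x = (q x)⁻¹ • v x := by
  rw [coe_divField hq]

theorem _root_.Continuous.divField {f : S → TorusC d 2 ℝ} {g : S → TorusC d 1 (Space d)}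
    (hf : Continuous f) (hg : Continuous g) (hpos : ∀ s, Pos (f s)) :
    Continuous fun s => divField (f s) (g s) := by
  have hfc := hf.torusC_apply
  have hgc := hg.torusC_apply
  have hinv : Continuous fun p : S × Space d => (f p.1 p.2)⁻¹ :=
    hfc.inv₀ fun p => (hpos p.1 p.2).ne'
  refine continuous_of_continuous_fderiv ?_ ?_
  · simp_rw [fun s => divField_apply (hpos s) (g s)]
    exact hinv.smul hgc
  have h : ∀ p : S × Space d, fderiv ℝ (TorusC.divField (f p.1) (g p.1)) p.2 =
      (f p.1 p.2)⁻¹ • fderiv ℝ (g p.1) p.2 +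
        (-(f p.1 p.2 ^ 2)⁻¹ • fderiv ℝ (f p.1) p.2).smulRight (g p.1 p.2) := by
    intro p
    rw [coe_divField (hpos p.1)]
    have hi : HasFDerivAt (fun y => (f p.1 y)⁻¹)
        (-(f p.1 p.2 ^ 2)⁻¹ • fderiv ℝ (f p.1) p.2) p.2 := by
      simpa [Function.comp_def] using (hasDerivAt_inv (hpos p.1 p.2).ne').comp_hasFDerivAt p.2
        ((f p.1).hasFDerivAt_coe one_le_two p.2)
    exact (hi.fun_smul ((g p.1).hasFDerivAt_coe le_rfl p.2)).fderiv
  simp_rw [h]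
  have hc : Continuous fun p : S × Space d => -(f p.1 p.2 ^ 2)⁻¹ • fderiv ℝ (f p.1) p.2 :=
    ((hfc.pow 2).inv₀ fun p => (pow_pos (hpos p.1 p.2) 2).ne').neg.smul
      (hf.torusC_fderiv one_le_two)
  exact (hinv.smul (hg.torusC_fderiv le_rfl)).add
    ((ContinuousLinearMap.smulRightL ℝ (Space d) (Space d)).continuous₂.comp₂ hc hgc)

end TorusC

end MFG

end

/-! ### Positive states and functional derivatives -/

noncomputable section

namespace MFG

open Filter Topology Metric

variable {d : ℕ}

open TorusC

/-- Evaluation is jointly continuous, and compactness of the cube makes positivity persist at all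
points simultaneously. -/
theorem isOpen_pos (d : ℕ) : IsOpen {q : TorusC d 2 ℝ | Pos q} := by
  rw [isOpen_iff_eventually]
  intro q hq
  have h := (isCompact_closedCube d).eventually_forall_of_forall_eventually (x₀ := q)
    (P := fun (q : TorusC d 2 ℝ) x => 0 < q x) fun x _ =>
      continuous_apply_apply.continuousAt.eventually (lt_mem_nhds (hq x))
  filter_upwards [h] with p hp x
  obtain ⟨y, hy, hyx⟩ := p.isPeriodic.exists_mem_closedCube x
  rw [← hyx]
  exact hp y hy

theorem zero_mem_closedCube (d : ℕ) : (0 : Space d) ∈ closedCube d := fun i => by simp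

theorem exists_pos_le {q : ℝ → TorusC d 2 ℝ} (hq : Continuous q) {t T : ℝ} (htT : t ≤ T)
    (hpos : ∀ s ∈ Icc t T, Pos (q s)) : ∃ δ > 0, ∀ s ∈ Icc t T, ∀ x, δ ≤ q s x := by
  obtain ⟨⟨s₀, x₀⟩, ⟨hs₀, -⟩, hmin⟩ := ((isCompact_Icc (a := t) (b := T)).prod
    (isCompact_closedCube d)).exists_isMinOn
    ⟨(t, 0), ⟨left_mem_Icc.2 htT, zero_mem_closedCube d⟩⟩ hq.torusC_apply.continuousOn
  refine ⟨q s₀ x₀, hpos s₀ hs₀ x₀, fun s hs x => ?_⟩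
  obtain ⟨y, hy, hyx⟩ := (q s).isPeriodic.exists_mem_closedCube x
  rw [← hyx]
  exact hmin (mk_mem_prod hs hy)

theorem abs_torusInt_mul_le {j k : ℕ} (f : TorusC d j ℝ) (g : TorusC d k ℝ) :
    |torusInt (fun x => f x * g x)| ≤ ‖f‖ * ‖g‖ := by
  refine abs_torusInt_le fun x => ?_
  rw [abs_mul]
  exact mul_le_mul (f.norm_apply_le x) (g.norm_apply_le x) (abs_nonneg _) (norm_nonneg _)

namespace IsFunctionalDerivative

variable {Φ : TorusC d 2 ℝ → ℝ} {F : TorusC d 2 ℝ → TorusC d 0 ℝ}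

/-- The definition differentiates only at `ε = 0`; moving the base point to `q + ε η` gives the
derivative along the whole line. -/
theorem hasDerivAt_line (hF : IsFunctionalDerivative Φ F) {q η : TorusC d 2 ℝ} {ε : ℝ}
    (h : Pos (q + ε • η)) : HasDerivAt (fun r : ℝ => Φ (q + r • η))
      (torusInt (fun x => F (q + ε • η) x * η x)) ε := by
  have h1 := hF _ h η
  rw [← sub_self ε] at h1
  have h2 := h1.comp_sub_const ε ε
  have h3 : ∀ r : ℝ, q + ε • η + (r - ε) • η = q + r • η := fun r => by
    rw [add_assoc, ← add_smul, add_sub_cancel]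
  simpa only [h3] using h2

/-- Continuity of the functional is not a hypothesis, yet the running cost must be integrable in
time. Near `q₀` the derivative `F` is bounded, so the mean value inequality along segments from `q₀`
gives a Lipschitz estimate at `q₀`. -/
theorem continuousOn (hF : IsFunctionalDerivative Φ F) (hFc : ContinuousOn F {q | Pos q}) :
    ContinuousOn Φ {q | Pos q} := by
  intro q₀ hq₀
  refine ContinuousAt.continuousWithinAt ?_
  have hnhds := (isOpen_pos d).mem_nhds hq₀
  have hb : ∀ᶠ q in 𝓝 q₀, ‖F q‖ < ‖F q₀‖ + 1 :=
    (hFc.continuousAt hnhds).norm.eventually (gt_mem_nhds (lt_add_one _))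
  obtain ⟨r, hr, hball⟩ := Metric.mem_nhds_iff.1 (inter_mem hnhds hb)
  have hlip : ∀ q ∈ ball q₀ r, ‖Φ q - Φ q₀‖ ≤ (‖F q₀‖ + 1) * ‖q - q₀‖ := by
    intro q hq
    have hseg : ∀ ε ∈ Icc (0 : ℝ) 1, q₀ + ε • (q - q₀) ∈ ball q₀ r := by
      intro ε hε
      rw [mem_ball_iff_norm] at hq ⊢
      rw [add_sub_cancel_left, norm_smul, Real.norm_eq_abs, abs_of_nonneg hε.1]
      exact (mul_le_of_le_one_left (norm_nonneg _) hε.2).trans_lt hq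
    have h := norm_image_sub_le_of_norm_deriv_le_segment_01' (f := fun ε : ℝ => Φ (q₀ + ε • (q - q₀)))
      (C := (‖F q₀‖ + 1) * ‖q - q₀‖)
      (fun ε hε => (hF.hasDerivAt_line (hball (hseg ε hε)).1).hasDerivWithinAt)
      (fun ε hε => (abs_torusInt_mul_le _ _).trans (mul_le_mul_of_nonneg_right
        (hball (hseg ε (Ico_subset_Icc_self hε))).2.le (norm_nonneg _)))
    simpa using h
  have hlim : Tendsto (fun q => (‖F q₀‖ + 1) * ‖q - q₀‖) (𝓝 q₀) (𝓝 0) := by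
    have : Continuous fun q : TorusC d 2 ℝ => (‖F q₀‖ + 1) * ‖q - q₀‖ := by fun_prop
    simpa using this.tendsto q₀
  rw [ContinuousAt, tendsto_iff_norm_sub_tendsto_zero]
  exact squeeze_zero' (Eventually.of_forall fun _ => norm_nonneg _)
    (by filter_upwards [ball_mem_nhds q₀ hr] with q hq using hlip q hq) hlim

theorem continuous_torusInt_mul {S : Type*} [TopologicalSpace S] [FirstCountableTopology S]
    [LocallyCompactSpace S] (hFc : ContinuousOn F {q | Pos q}) {q η : S → TorusC d 2 ℝ}
    (hq : Continuous q) (hη : Continuous η) (hpos : ∀ s, Pos (q s)) :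
    Continuous fun s => torusInt (fun x => F (q s) x * η s x) :=
  continuous_torusInt ((hFc.comp_continuous hq hpos).torusC_apply.mul hη.torusC_apply)

/-- The derivative of a running cost along a linear perturbation of a curve of states. -/
theorem hasDerivAt_integral (hF : IsFunctionalDerivative Φ F)
    (hFc : ContinuousOn F {q | Pos q}) {q η : ℝ → TorusC d 2 ℝ} (hq : Continuous q)
    (hη : Continuous η) {t T ε₀ : ℝ} (htT : t ≤ T) (hε₀ : 0 < ε₀)
    (hpos : ∀ ε ∈ Icc (-ε₀) ε₀, ∀ s ∈ Icc t T, Pos (q s + ε • η s)) :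
    HasDerivAt (fun ε : ℝ => ∫ s in t..T, Φ (q s + ε • η s))
      (∫ s in t..T, torusInt (fun x => F (q s) x * η s x)) 0 := by
  have hcurve : Continuous fun p : ℝ × ℝ => q p.2 + p.1 • η p.2 := by fun_prop
  have hslice : ∀ ε : ℝ, Continuous fun s => q s + ε • η s := by fun_prop
  have hmaps : MapsTo (fun p : ℝ × ℝ => q p.2 + p.1 • η p.2) (Icc (-ε₀) ε₀ ×ˢ Icc t T)
      {q | Pos q} := fun p hp => hpos p.1 hp.1 p.2 hp.2
  -- The perturbed states range over a compact family, so `F` is bounded on it; `C * M` then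
  -- dominates the `ε`-derivative.
  obtain ⟨C, hC⟩ := (isCompact_Icc.prod isCompact_Icc).exists_bound_of_continuousOn
    (hFc.comp hcurve.continuousOn hmaps)
  obtain ⟨M, hM⟩ := (isCompact_Icc (a := t) (b := T)).exists_bound_of_continuousOn hη.continuousOn
  have hC0 : 0 ≤ C := (norm_nonneg _).trans
    (hC (0, t) ⟨⟨by linarith, hε₀.le⟩, left_mem_Icc.2 htT⟩)
  have hΦc : ∀ ε ∈ Icc (-ε₀) ε₀, ContinuousOn (fun s => Φ (q s + ε • η s)) (Icc t T) :=
    fun ε hε => (hF.continuousOn hFc).comp (hslice ε).continuousOn fun s hs => hpos ε hε s hs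
  have h0 : (0 : ℝ) ∈ Icc (-ε₀) ε₀ := ⟨by linarith, hε₀.le⟩
  have hmem : Icc (-ε₀) ε₀ ∈ 𝓝 (0 : ℝ) := Icc_mem_nhds (by linarith) hε₀
  have hI : uIoc t T ⊆ Icc t T := by
    rw [uIoc_of_le htT]
    exact Ioc_subset_Icc_self
  have hF' : ContinuousOn (fun s => torusInt (fun x => F (q s + (0 : ℝ) • η s) x * η s x))
      (Icc t T) := by
    rw [continuousOn_iff_continuous_domRestrict]
    exact continuous_torusInt_mul (S := Icc t T) hFc
      ((hslice 0).comp continuous_subtype_val) (hη.comp continuous_subtype_val)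
      fun s => hpos 0 h0 s s.2
  have h := intervalIntegral.hasDerivAt_integral_of_dominated_loc_of_deriv_le (μ := volume)
    (F := fun (ε : ℝ) s => Φ (q s + ε • η s))
    (F' := fun (ε : ℝ) s => torusInt (fun x => F (q s + ε • η s) x * η s x))
    (a := t) (b := T) (x₀ := 0) (bound := fun _ => C * M) hmem
    (by filter_upwards [hmem] with ε hε using
      ((hΦc ε hε).mono hI).aestronglyMeasurable measurableSet_uIoc)
    ((hΦc 0 h0).intervalIntegrable_of_Icc htT)
    ((hF'.mono hI).aestronglyMeasurable measurableSet_uIoc)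
    (Eventually.of_forall fun s hs ε hε => (abs_torusInt_mul_le _ _).trans
      (mul_le_mul (hC (ε, s) ⟨hε, hI hs⟩) (hM s (hI hs)) (norm_nonneg _) hC0))
    intervalIntegrable_const
    (Eventually.of_forall fun s hs ε hε => hF.hasDerivAt_line (hpos ε hε s (hI hs)))
  simpa using h.2

end IsFunctionalDerivative

end MFG

end

/-! ### Variation of an optimal pair -/

noncomputable section

namespace MFG

open Filter Topology Metric

variable {d : ℕ}

open TorusC

/-- Second-order expansion of the kinetic energy along a variation of state and flux. -/
theorem kinetic_le {V : Type*} [NormedAddCommGroup V] [InnerProductSpace ℝ V] {Q η δ ε : ℝ}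
    (hδ : 0 < δ) (hQ : δ ≤ Q + ε * η) (hε : |ε| ≤ 1) (a b e y : V) :
    1 / 2 * ‖(Q + ε * η)⁻¹ • (Q • (b + a) + ε • y) - (b + ε • e)‖ ^ 2 * (Q + ε * η) ≤
      1 / 2 * ‖a‖ ^ 2 * Q
      + ε * (inner ℝ a y - η * (1 / 2 * ‖a‖ ^ 2 + inner ℝ a b) - Q * inner ℝ a e)
      + ε ^ 2 * (-(η * inner ℝ a e)
        + δ⁻¹ * (‖y - η • (b + a) - Q • e‖ ^ 2 + ‖η • e‖ ^ 2)) := by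
  set P := Q + ε * η with hP
  have hP0 : 0 < P := hδ.trans_le hQ
  set N₀ := y - η • (b + a) - Q • e with hN₀
  set N₁ := η • e with hN₁
  -- Writing the new control as `a + (ε / P) N` makes the energy `½|a|²P + ε a·N + ½ε²|N|²/P`:
  -- dividing by `P` affects only the quadratic term, which `P ≥ δ` controls.
  have hβ : P⁻¹ • (Q • (b + a) + ε • y) - (b + ε • e) = a + (ε * P⁻¹) • (N₀ - ε • N₁) := by
    have hPe : P⁻¹ * P = 1 := inv_mul_cancel₀ hP0.ne'
    have h1 : b + ε • e = P⁻¹ • (P • (b + ε • e)) := by rw [smul_smul, hPe, one_smul]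
    have h2 : a = P⁻¹ • (P • a) := by rw [smul_smul, hPe, one_smul]
    rw [h1]
    nth_rw 2 [h2]
    rw [mul_comm ε, mul_smul, ← smul_sub, ← smul_add, hN₀, hN₁]
    congr 1
    rw [hP]
    module
  have hN : ‖N₀ - ε • N₁‖ ^ 2 ≤ 2 * (‖N₀‖ ^ 2 + ‖N₁‖ ^ 2) := by
    have h1 : ‖N₀ - ε • N₁‖ ≤ ‖N₀‖ + ‖N₁‖ := by
      refine (norm_sub_le _ _).trans (add_le_add le_rfl ?_)
      rw [norm_smul, Real.norm_eq_abs]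
      exact mul_le_of_le_one_left (norm_nonneg _) hε
    nlinarith [norm_nonneg (N₀ - ε • N₁), sq_nonneg (‖N₀‖ - ‖N₁‖), norm_nonneg N₀, norm_nonneg N₁]
  have hin : inner ℝ a (N₀ - ε • N₁) = inner ℝ a y - η * (‖a‖ ^ 2 + inner ℝ a b) - Q * inner ℝ a e
      - ε * (η * inner ℝ a e) := by
    simp only [hN₀, hN₁, inner_sub_right, inner_add_right, real_inner_smul_right,
      real_inner_self_eq_norm_sq]
    ring
  rw [hβ, norm_add_sq_real, real_inner_smul_right, hin, norm_smul, mul_pow, Real.norm_eq_abs,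
    sq_abs]
  have hquad : P⁻¹ * ‖N₀ - ε • N₁‖ ^ 2 ≤ δ⁻¹ * (2 * (‖N₀‖ ^ 2 + ‖N₁‖ ^ 2)) :=
    mul_le_mul (inv_anti₀ hδ hQ) hN (sq_nonneg _) (inv_nonneg.2 hδ.le)
  have hquad' := mul_le_mul_of_nonneg_left hquad (sq_nonneg ε)
  have hexp : ∀ w n : ℝ, 1 / 2 * (‖a‖ ^ 2 + 2 * (ε * P⁻¹ * w) + (ε * P⁻¹) ^ 2 * n) * P =
      1 / 2 * ‖a‖ ^ 2 * P + ε * w + 1 / 2 * (ε ^ 2 * (P⁻¹ * n)) := by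
    intro w n
    field_simp
  have hPQ : 1 / 2 * ‖a‖ ^ 2 * P = 1 / 2 * ‖a‖ ^ 2 * Q + ε * (η * (1 / 2 * ‖a‖ ^ 2)) := by
    rw [hP]
    ring
  rw [hexp, hPQ]
  linarith

/-- The control steering the state `q + ε η` with the total flux of `(q, α)` changed by `ε y`. -/
def perturbedControl (𝒯 : TorusC d 2 ℝ →L[ℝ] TorusC d 1 (Space d)) (q : TorusC d 2 ℝ)
    (α : TorusC d 1 (Space d)) (η : TorusC d 2 ℝ) (y : TorusC d 1 (Space d)) (ε : ℝ) :
    TorusC d 1 (Space d) :=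
  divField (q + ε • η) (mulField q (𝒯 q + α) + ε • y) - 𝒯 (q + ε • η)

variable {𝒯 : TorusC d 2 ℝ →L[ℝ] TorusC d 1 (Space d)} {D t T : ℝ} {q₀ : TorusC d 2 ℝ}

theorem perturbedControl_apply {q : TorusC d 2 ℝ} {α : TorusC d 1 (Space d)} {η : TorusC d 2 ℝ}
    {y : TorusC d 1 (Space d)} {ε : ℝ} (hpos : Pos (q + ε • η)) (x : Space d) :
    perturbedControl 𝒯 q α η y ε x =
      (q x + ε * η x)⁻¹ • (q x • (𝒯 q x + α x) + ε • y x) - (𝒯 q x + ε • 𝒯 η x) := by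
  simp [perturbedControl, divField_apply hpos]

/-- The perturbed control subtracts the velocity `𝒯(q + ε η)` that the equation adds back, so the
total flux is affine in `ε` and the right-hand side is too. -/
theorem continuityRHS_perturbedControl {q : TorusC d 2 ℝ} {α : TorusC d 1 (Space d)}
    {η : TorusC d 2 ℝ} {y : TorusC d 1 (Space d)} {ε : ℝ} (hpos : Pos (q + ε • η)) (x : Space d) :
    continuityRHS 𝒯 D (q + ε • η) (perturbedControl 𝒯 q α η y ε) x =
      continuityRHS 𝒯 D q α x + ε * (D * (Δ ⇑η) x - divg y x) := by
  have h1 : (fun z => (q + ε • η) z • (𝒯 (q + ε • η) z + perturbedControl 𝒯 q α η y ε z)) =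
      ⇑(mulField q (𝒯 q + α) + ε • y) := by
    funext z
    have hz : (q + ε • η) z ≠ 0 := (hpos z).ne'
    simp only [perturbedControl, coe_sub, Pi.sub_apply, add_sub_cancel, divField_apply hpos]
    rw [smul_inv_smul₀ hz]
  have h2 : (fun z => q z • (𝒯 q z + α z)) = ⇑(mulField q (𝒯 q + α)) := rfl
  rw [continuityRHS, continuityRHS, h1, h2, divg_coe_add, divg_coe_smul, laplacian_coe_add,
    laplacian_coe_smul]
  ring

/-- The term `D∇η` in the flux variation cancels the diffusion of `η = -X θ`, and `∇·(χ ζ) = χ θ`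
matches `-∂_s η`. The condition `X t = 0` preserves the initial state. -/
theorem IsAdmissible.perturb {q : ℝ → TorusC d 2 ℝ} {α : ℝ → TorusC d 1 (Space d)}
    (h : IsAdmissible 𝒯 D t T q₀ q α) {X χ : ℝ → ℝ} (hX : ∀ s, HasDerivAt X (χ s) s)
    (hχ : Continuous χ) (hXt : X t = 0) {θ : TorusC d 2 ℝ} {ζ : TorusC d 1 (Space d)}
    (hθ : ∀ x, divg ζ x = θ x) {ε : ℝ} (hpos : ∀ s ∈ Icc t T, Pos (q s + ε • -X s • θ)) :
    IsAdmissible 𝒯 D t T q₀ (fun s => q s + ε • -X s • θ)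
      (fun s => perturbedControl 𝒯 (q s) (α s) (-X s • θ) (D • -X s • grad θ + χ s • ζ) ε) where
  state_continuous := by
    have hXc : Continuous X := continuous_iff_continuousAt.2 fun s => (hX s).continuousAt
    exact h.state_continuous.add (by fun_prop)
  control_continuous := by
    have hXc : Continuous X := continuous_iff_continuousAt.2 fun s => (hX s).continuousAt
    have hq := continuousOn_iff_continuous_domRestrict.1 h.state_continuous
    have hα := continuousOn_iff_continuous_domRestrict.1 h.control_continuous
    rw [continuousOn_iff_continuous_domRestrict]
    have hq' : Continuous fun s : Icc t T => q s + ε • -X s • θ :=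
      hq.add (by fun_prop)
    have hy : Continuous fun s : Icc t T => ε • (D • -X s • grad θ + χ s • ζ) := by fun_prop
    exact (hq'.divField ((hq.mulField ((𝒯.continuous.comp hq).add hα)).add hy)
      fun s => hpos s s.2).sub (𝒯.continuous.comp hq')
  state_pos := hpos
  initial := by simp [h.initial, hXt]
  continuity s hs x := by
    rw [continuityRHS_perturbedControl (hpos s hs), divg_coe_add, divg_coe_smul, divg_coe_smul,
      divg_coe_smul, laplacian_coe_smul, divg_grad, hθ]
    have h1 := (h.continuity s hs x).add
      ((((hX s).neg.mul_const (θ x)).const_mul ε).hasDerivWithinAt (s := Icc t T))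
    refine h1.congr_deriv ?_
    ring

/-- Only an upper bound for the kinetic energy is needed: a majorant of the perturbed cost that
agrees with it at `ε = 0` also has a minimum there, so its derivative vanishes. -/
theorem IsOptimal.first_order {ℱ 𝒢 : TorusC d 2 ℝ → ℝ}
    {F G : TorusC d 2 ℝ → TorusC d 0 ℝ} {q : ℝ → TorusC d 2 ℝ} {α : ℝ → TorusC d 1 (Space d)}
    (h : IsOptimal 𝒯 D t T (fun a => 1 / 2 * ‖a‖ ^ 2) ℱ 𝒢 q₀ q α) (htT : t < T)
    (hF : IsFunctionalDerivative ℱ F) (hG : IsFunctionalDerivative 𝒢 G)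
    (hFc : ContinuousOn F {q | Pos q}) (hq : Continuous q) (hα : Continuous α)
    {X χ : ℝ → ℝ} (hX : ∀ s, HasDerivAt X (χ s) s)
    (hχ : Continuous χ) (hXt : X t = 0) {θ : TorusC d 2 ℝ} {ζ : TorusC d 1 (Space d)}
    (hθ : ∀ x, divg ζ x = θ x) :
    (∫ s in t..T, torusInt (fun x =>
        inner ℝ (α s x) ((D • -X s • grad θ + χ s • ζ : TorusC d 1 (Space d)) x)
        - (-X s • θ) x * (1 / 2 * ‖α s x‖ ^ 2 + inner ℝ (α s x) (𝒯 (q s) x))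
        - q s x * inner ℝ (α s x) (𝒯 (-X s • θ) x)))
      + ((∫ s in t..T, torusInt (fun x => F (q s) x * (-X s • θ) x))
        + torusInt (fun x => G (q T) x * (-X T • θ) x)) = 0 := by
  have hXc : Continuous X := continuous_iff_continuousAt.2 fun s => (hX s).continuousAt
  set η : ℝ → TorusC d 2 ℝ := fun s => -X s • θ with hη
  set y : ℝ → TorusC d 1 (Space d) := fun s => D • -X s • grad θ + χ s • ζ with hy
  have hηc : Continuous η := by fun_prop
  have hyc : Continuous y := by fun_prop
  obtain ⟨δ₀, hδ₀, hqδ⟩ := exists_pos_le hq htT.le h.1.state_pos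
  obtain ⟨M, hM⟩ := (isCompact_Icc (a := t) (b := T)).exists_bound_of_continuousOn hηc.continuousOn
  have hM0 : 0 ≤ M := (norm_nonneg _).trans (hM t (left_mem_Icc.2 htT.le))
  -- The bound `1` is what `kinetic_le` requires; the other keeps `|ε η| ≤ δ₀ / 2`, so the perturbed
  -- density stays above `δ₀ / 2`.
  set ε₀ := min 1 (δ₀ / (2 * (M + 1))) with hε₀
  have hε₀pos : 0 < ε₀ := by positivity
  set δ := δ₀ / 2 with hδ
  have hδpos : 0 < δ := by positivity
  have hlow : ∀ ε ∈ Icc (-ε₀) ε₀, ∀ s ∈ Icc t T, ∀ x, δ ≤ q s x + ε * η s x := by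
    intro ε hε s hs x
    have h1 := hqδ s hs x
    have h2 : |η s x| ≤ M := ((η s).norm_apply_le x).trans (hM s hs)
    have h3 : |ε| ≤ δ₀ / (2 * (M + 1)) := (abs_le.2 hε).trans (min_le_right _ _)
    have h4 : |ε * η s x| ≤ δ₀ / (2 * (M + 1)) * M := by
      rw [abs_mul]
      exact mul_le_mul h3 h2 (abs_nonneg _) (by positivity)
    have h5 : δ₀ / (2 * (M + 1)) * M ≤ δ₀ / 2 := by
      rw [div_mul_eq_mul_div, div_le_div_iff₀ (by positivity) two_pos]
      nlinarith
    have := neg_abs_le (ε * η s x)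
    linarith
  have hposε : ∀ ε ∈ Icc (-ε₀) ε₀, ∀ s ∈ Icc t T, Pos (q s + ε • η s) :=
    fun ε hε s hs x => hδpos.trans_le (hlow ε hε s hs x)
  -- `k` and `R` are the coefficients of `ε` and `ε ^ 2` in `kinetic_le`, taken with `b = 𝒯 q` and
  -- `e = 𝒯 η`.
  set k : ℝ → Space d → ℝ := fun s x => inner ℝ (α s x) (y s x)
    - η s x * (1 / 2 * ‖α s x‖ ^ 2 + inner ℝ (α s x) (𝒯 (q s) x))
    - q s x * inner ℝ (α s x) (𝒯 (η s) x) with hk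
  set R : ℝ → Space d → ℝ := fun s x => -(η s x * inner ℝ (α s x) (𝒯 (η s) x))
    + δ⁻¹ * (‖y s x - η s x • (𝒯 (q s) x + α s x) - q s x • 𝒯 (η s) x‖ ^ 2
      + ‖η s x • 𝒯 (η s) x‖ ^ 2) with hR
  have hqj := hq.torusC_apply
  have hαj := hα.torusC_apply
  have hηj := hηc.torusC_apply
  have hyj := hyc.torusC_apply
  have hTqj := (𝒯.continuous.comp hq).torusC_apply
  have hTηj := (𝒯.continuous.comp hηc).torusC_apply
  simp only [Function.comp_apply] at hTqj hTηj
  have hkj : Continuous fun p : ℝ × Space d => k p.1 p.2 :=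
    ((hαj.inner hyj).sub (hηj.mul ((continuous_const.mul (hαj.norm.pow 2)).add
      (hαj.inner hTqj)))).sub (hqj.mul (hαj.inner hTηj))
  have hRj : Continuous fun p : ℝ × Space d => R p.1 p.2 :=
    (hηj.mul (hαj.inner hTηj)).neg.add (continuous_const.mul
      ((((hyj.sub (hηj.smul (hTqj.add hαj))).sub (hqj.smul hTηj)).norm.pow 2).add
        ((hηj.smul hTηj).norm.pow 2)))
  have hEj : Continuous fun p : ℝ × Space d => 1 / 2 * ‖α p.1 p.2‖ ^ 2 * q p.1 p.2 := by fun_prop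
  have hslice : ∀ {f : ℝ → Space d → ℝ}, (Continuous fun p : ℝ × Space d => f p.1 p.2) →
      ∀ s, Continuous (f s) := fun hf s => hf.comp (by fun_prop : Continuous fun x => (s, x))
  set E : ℝ → ℝ → ℝ := fun ε s => torusInt (fun x =>
    1 / 2 * ‖perturbedControl 𝒯 (q s) (α s) (η s) (y s) ε x‖ ^ 2 * (q s + ε • η s) x) with hE
  set E₀ : ℝ → ℝ := fun s => torusInt (fun x => 1 / 2 * ‖α s x‖ ^ 2 * q s x) with hE₀
  have hkc : Continuous fun s => torusInt (k s) := continuous_torusInt hkj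
  have hRc : Continuous fun s => torusInt (R s) := continuous_torusInt hRj
  have hE₀c : Continuous E₀ :=
    continuous_torusInt (f := fun s x => 1 / 2 * ‖α s x‖ ^ 2 * q s x) hEj
  have hadm : ∀ ε ∈ Icc (-ε₀) ε₀, IsAdmissible 𝒯 D t T q₀ (fun s => q s + ε • η s)
      (fun s => perturbedControl 𝒯 (q s) (α s) (η s) (y s) ε) :=
    fun ε hε => h.1.perturb hX hχ hXt hθ (hposε ε hε)
  have hEc : ∀ ε ∈ Icc (-ε₀) ε₀, ContinuousOn (E ε) (Icc t T) := by
    intro ε hε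
    rw [continuousOn_iff_continuous_domRestrict]
    have h1 := (continuousOn_iff_continuous_domRestrict.1 (hadm ε hε).state_continuous).torusC_apply
    have h2 := (continuousOn_iff_continuous_domRestrict.1
      (hadm ε hε).control_continuous).torusC_apply
    exact continuous_torusInt (S := Icc t T) ((continuous_const.mul (h2.norm.pow 2)).mul h1)
  have hEle : ∀ ε ∈ Icc (-ε₀) ε₀, ∀ s ∈ Icc t T,
      E ε s ≤ E₀ s + ε * torusInt (k s) + ε ^ 2 * torusInt (R s) := by
    intro ε hε s hs
    have hεk : Continuous fun x => ε * k s x := (hslice hkj s).const_mul ε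
    have hεR : Continuous fun x => ε ^ 2 * R s x := (hslice hRj s).const_mul (ε ^ 2)
    have hEs : Continuous fun x => 1 / 2 * ‖α s x‖ ^ 2 * q s x :=
      hslice (f := fun s x => 1 / 2 * ‖α s x‖ ^ 2 * q s x) hEj s
    have hEk : Continuous fun x => 1 / 2 * ‖α s x‖ ^ 2 * q s x + ε * k s x := hEs.add hεk
    rw [← torusInt_const_mul, ← torusInt_const_mul, hE₀, ← torusInt_add hEs hεk,
      ← torusInt_add hEk hεR]
    refine torusInt_mono ?_ (hEk.add hεR) fun x => ?_
    · have h1 := (perturbedControl 𝒯 (q s) (α s) (η s) (y s) ε).continuous_coe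
      have h2 := (q s + ε • η s).continuous_coe
      fun_prop
    · rw [perturbedControl_apply (hposε ε hε s hs)]
      exact kinetic_le hδpos (hlow ε hε s hs x) ((abs_le.2 hε).trans (min_le_left _ _)) _ _ _ _
  set Φ : ℝ → ℝ := fun ε => (∫ s in t..T, ℱ (q s + ε • η s)) + 𝒢 (q T + ε • η T) with hΦ
  have hΦd : HasDerivAt Φ ((∫ s in t..T, torusInt (fun x => F (q s) x * η s x))
      + torusInt (fun x => G (q T) x * η T x)) 0 :=
    (hF.hasDerivAt_integral hFc hq hηc htT.le hε₀pos hposε).add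
      (hG _ (h.1.state_pos T (right_mem_Icc.2 htT.le)) _)
  have hℱc : ∀ ε ∈ Icc (-ε₀) ε₀, ContinuousOn (fun s => ℱ (q s + ε • η s)) (Icc t T) := by
    intro ε hε
    exact (hF.continuousOn hFc).comp (by fun_prop) fun s hs => hposε ε hε s hs
  set K := ∫ s in t..T, torusInt (k s) with hK
  set C := ∫ s in t..T, torusInt (R s) with hC
  -- Optimality after cancelling the unperturbed kinetic energy from both sides.
  have hineq : ∀ ε ∈ Icc (-ε₀) ε₀, Φ 0 ≤ ε * K + ε ^ 2 * C + Φ ε := by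
    intro ε hε
    have h0 : (0 : ℝ) ∈ Icc (-ε₀) ε₀ := ⟨by linarith, hε₀pos.le⟩
    have h1 := h.2 _ _ (hadm ε hε)
    have h2 : ∫ s in t..T, (E ε s + ℱ (q s + ε • η s)) =
        (∫ s in t..T, E ε s) + ∫ s in t..T, ℱ (q s + ε • η s) :=
      intervalIntegral.integral_add ((hEc ε hε).intervalIntegrable_of_Icc htT.le)
        ((hℱc ε hε).intervalIntegrable_of_Icc htT.le)
    have hℱ0 := hℱc 0 h0
    simp only [zero_smul, add_zero] at hℱ0
    have h3 : ∫ s in t..T, (E₀ s + ℱ (q s)) = (∫ s in t..T, E₀ s) + ∫ s in t..T, ℱ (q s) :=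
      intervalIntegral.integral_add (hE₀c.intervalIntegrable _ _)
        (hℱ0.intervalIntegrable_of_Icc htT.le)
    have hεk : Continuous fun s => ε * torusInt (k s) := hkc.const_mul ε
    have hεR : Continuous fun s => ε ^ 2 * torusInt (R s) := hRc.const_mul (ε ^ 2)
    have hE₀k : Continuous fun s => E₀ s + ε * torusInt (k s) := hE₀c.add hεk
    have h4 : ∫ s in t..T, E ε s ≤ (∫ s in t..T, E₀ s) + ε * K + ε ^ 2 * C := by
      rw [hK, hC, ← intervalIntegral.integral_const_mul, ← intervalIntegral.integral_const_mul,
        ← intervalIntegral.integral_add (hE₀c.intervalIntegrable _ _) (hεk.intervalIntegrable _ _),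
        ← intervalIntegral.integral_add (hE₀k.intervalIntegrable _ _)
          (hεR.intervalIntegrable _ _)]
      exact intervalIntegral.integral_mono_on htT.le ((hEc ε hε).intervalIntegrable_of_Icc htT.le)
        ((hE₀k.add hεR).intervalIntegrable _ _) (hEle ε hε)
    have h5 : cost (fun a => 1 / 2 * ‖a‖ ^ 2) ℱ 𝒢 t T q α =
        𝒢 (q T) + ∫ s in t..T, (E₀ s + ℱ (q s)) := rfl
    have h6 : cost (fun a => 1 / 2 * ‖a‖ ^ 2) ℱ 𝒢 t T (fun s => q s + ε • η s)
        (fun s => perturbedControl 𝒯 (q s) (α s) (η s) (y s) ε) =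
        𝒢 (q T + ε • η T) + ∫ s in t..T, (E ε s + ℱ (q s + ε • η s)) := rfl
    rw [h5, h6, h2, h3] at h1
    simp only [hΦ, zero_smul, add_zero]
    linarith
  have hd : HasDerivAt (fun ε : ℝ => ε * K + ε ^ 2 * C + Φ ε)
      (K + ((∫ s in t..T, torusInt (fun x => F (q s) x * η s x))
      + torusInt (fun x => G (q T) x * η T x))) 0 := by
    have h1 := (((hasDerivAt_id (0 : ℝ)).mul_const K).add
      (((hasDerivAt_id (0 : ℝ)).pow 2).mul_const C)).add hΦd
    exact h1.congr_deriv (by simp)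
  refine IsLocalMin.hasDerivAt_eq_zero ?_ hd
  filter_upwards [Icc_mem_nhds (neg_lt_zero.2 hε₀pos) hε₀pos] with ε hε
  simpa using hineq ε hε

end MFG

end

/-! ### The adjoint state and the backward equation -/

noncomputable section

namespace MFG

open Filter Topology Metric

variable {d : ℕ}

open TorusC

variable {𝒯 : TorusC d 2 ℝ →L[ℝ] TorusC d 1 (Space d)}
  {Tadj : TorusC d 1 (Space d) →L[ℝ] TorusC d 0 ℝ} {D t T : ℝ} {q₀ : TorusC d 2 ℝ}

/-- The time derivative of the adjoint state prescribed by the backward equation, written in terms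
of the control `α = ∇φ`. -/
def adjointRHS (𝒯 : TorusC d 2 ℝ →L[ℝ] TorusC d 1 (Space d))
    (Tadj : TorusC d 1 (Space d) →L[ℝ] TorusC d 0 ℝ) (D : ℝ) (f : TorusC d 0 ℝ) (q : TorusC d 2 ℝ)
    (α : TorusC d 1 (Space d)) (x : Space d) : ℝ :=
  f x - 1 / 2 * ‖α x‖ ^ 2 - inner ℝ (α x) (𝒯 q x) - Tadj (mulField q α) x - D * divg α x

/-- The first variation of the running cost after integration by parts. -/
theorem torusInt_first_variation (hadj : IsL2Adjoint 𝒯 Tadj) (f : TorusC d 0 ℝ)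
    (q θ : TorusC d 2 ℝ) (α ζ : TorusC d 1 (Space d)) (c χ : ℝ) :
    torusInt (fun x => inner ℝ (α x) ((D • c • grad θ + χ • ζ : TorusC d 1 (Space d)) x)
        - (c • θ) x * (1 / 2 * ‖α x‖ ^ 2 + inner ℝ (α x) (𝒯 q x))
        - q x * inner ℝ (α x) (𝒯 (c • θ) x)) + torusInt (fun x => f x * (c • θ) x) =
      χ * torusInt (fun x => inner ℝ (α x) (ζ x))
        + c * torusInt (fun x => adjointRHS 𝒯 Tadj D f q α x * θ x) := by
  have cα := α.continuous_coe
  have cq := q.continuous_coe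
  have cθ := θ.continuous_coe
  have cf := f.continuous_coe
  have cS := (Tadj (mulField q α)).continuous_coe
  have cdiv : Continuous (divg α) :=
    continuous_divg_apply.comp (by fun_prop : Continuous fun x => (α, x))
  have c1 : Continuous fun x => inner ℝ (α x) (grad θ x) := cα.inner (grad θ).continuous_coe
  have c2 : Continuous fun x => inner ℝ (α x) (ζ x) := cα.inner ζ.continuous_coe
  have c3 : Continuous fun x => (1 / 2 * ‖α x‖ ^ 2 + inner ℝ (α x) (𝒯 q x)) * θ x :=
    ((continuous_const.mul (cα.norm.pow 2)).add (cα.inner (𝒯 q).continuous_coe)).mul cθ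
  have c4 : Continuous fun x => inner ℝ (mulField q α x) (𝒯 θ x) :=
    (mulField q α).continuous_coe.inner (𝒯 θ).continuous_coe
  have c5 : Continuous fun x => f x * θ x := cf.mul cθ
  have c6 : Continuous fun x => Tadj (mulField q α) x * θ x := cS.mul cθ
  have c7 : Continuous fun x => divg α x * θ x := cdiv.mul cθ
  have e1 : ∀ x, inner ℝ (α x) ((D • c • grad θ + χ • ζ : TorusC d 1 (Space d)) x)
        - (c • θ) x * (1 / 2 * ‖α x‖ ^ 2 + inner ℝ (α x) (𝒯 q x))
        - q x * inner ℝ (α x) (𝒯 (c • θ) x) =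
      (D * c) * inner ℝ (α x) (grad θ x) + χ * inner ℝ (α x) (ζ x)
        - c * ((1 / 2 * ‖α x‖ ^ 2 + inner ℝ (α x) (𝒯 q x)) * θ x)
        - c * inner ℝ (mulField q α x) (𝒯 θ x) := by
    intro x
    simp only [coe_add, coe_smul, Pi.add_apply, Pi.smul_apply, inner_add_right,
      real_inner_smul_right, map_smul, smul_eq_mul, mulField_apply, real_inner_smul_left]
    ring
  have e2 : ∀ x, f x * (c • θ) x = c * (f x * θ x) := by
    intro x
    simp only [coe_smul, Pi.smul_apply, smul_eq_mul]
    ring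
  have e3 : ∀ x, adjointRHS 𝒯 Tadj D f q α x * θ x =
      f x * θ x - (1 / 2 * ‖α x‖ ^ 2 + inner ℝ (α x) (𝒯 q x)) * θ x
        - Tadj (mulField q α) x * θ x - D * (divg α x * θ x) := by
    intro x
    rw [adjointRHS]
    ring
  have m1 := c1.const_mul (D * c)
  have m2 := c2.const_mul χ
  have m3 := c3.const_mul c
  have m4 := c4.const_mul c
  have m7 := c7.const_mul D
  have a12 : Continuous fun x =>
      (D * c) * inner ℝ (α x) (grad θ x) + χ * inner ℝ (α x) (ζ x) := m1.add m2
  have a123 : Continuous fun x => (D * c) * inner ℝ (α x) (grad θ x) + χ * inner ℝ (α x) (ζ x)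
        - c * ((1 / 2 * ‖α x‖ ^ 2 + inner ℝ (α x) (𝒯 q x)) * θ x) := a12.sub m3
  have b1 : Continuous fun x =>
      f x * θ x - (1 / 2 * ‖α x‖ ^ 2 + inner ℝ (α x) (𝒯 q x)) * θ x := c5.sub c3
  have b2 : Continuous fun x => f x * θ x
      - (1 / 2 * ‖α x‖ ^ 2 + inner ℝ (α x) (𝒯 q x)) * θ x - Tadj (mulField q α) x * θ x := b1.sub c6
  simp only [e1, e2, e3]
  rw [torusInt_sub a123 m4, torusInt_sub a12 m3, torusInt_add m1 m2, torusInt_sub b2 m7,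
    torusInt_sub b1 c6, torusInt_sub c5 c3]
  simp only [torusInt_const_mul]
  rw [torusInt_inner_grad, hadj θ (mulField q α)]
  ring

theorem continuous_adjointRHS {S : Type*} [TopologicalSpace S] {f : S → TorusC d 0 ℝ}
    {q : S → TorusC d 2 ℝ} {α : S → TorusC d 1 (Space d)} (hf : Continuous f) (hq : Continuous q)
    (hα : Continuous α) :
    Continuous fun p : S × Space d => adjointRHS 𝒯 Tadj D (f p.1) (q p.1) (α p.1) p.2 := by
  have hαj := hα.torusC_apply
  have hdiv : Continuous fun p : S × Space d => divg (α p.1) p.2 :=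
    continuous_divg_apply.comp ((hα.comp continuous_fst).prodMk continuous_snd)
  exact (((hf.torusC_apply.sub (continuous_const.mul (hαj.norm.pow 2))).sub
    (hαj.inner (𝒯.continuous.comp hq).torusC_apply)).sub
    (Tadj.continuous.comp (hq.mulField hα)).torusC_apply).sub (continuous_const.mul hdiv)

theorem eqOn_zero_of_integral_sq_eq_zero {f : ℝ → ℝ} (hf : Continuous f) (htT : t < T)
    (h : ∫ s in t..T, f s ^ 2 = 0) : ∀ s ∈ Icc t T, f s = 0 := by
  intro s hs
  by_contra hne
  exact (intervalIntegral.integral_pos htT (hf.pow 2).continuousOn (fun x _ => sq_nonneg (f x))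
    ⟨s, hs, sq_pos_iff.2 hne⟩).ne' h

/-- The optimal control is the weak gradient of the adjoint state. -/
theorem IsOptimal.weak_gradient {ℱ 𝒢 : TorusC d 2 ℝ → ℝ}
    {F G : TorusC d 2 ℝ → TorusC d 0 ℝ} {q : ℝ → TorusC d 2 ℝ} {α : ℝ → TorusC d 1 (Space d)}
    (h : IsOptimal 𝒯 D t T (fun a => 1 / 2 * ‖a‖ ^ 2) ℱ 𝒢 q₀ q α) (hadj : IsL2Adjoint 𝒯 Tadj)
    (htT : t < T) (hF : IsFunctionalDerivative ℱ F) (hG : IsFunctionalDerivative 𝒢 G)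
    (hFc : ContinuousOn F {q | Pos q}) (hq : Continuous q) (hα : Continuous α)
    {φ : ℝ → Space d → ℝ} (hφc : ∀ s, Continuous (φ s))
    (hKc : Continuous fun p : ℝ × Space d =>
      adjointRHS 𝒯 Tadj D (F (q p.1)) (q p.1) (α p.1) p.2)
    (hφ : ∀ s x, HasDerivAt (fun r => φ r x) (adjointRHS 𝒯 Tadj D (F (q s)) (q s) (α s) x) s)
    (hφT : ∀ x, φ T x = -G (q T) x) {θ : TorusC d 2 ℝ} {ζ : TorusC d 1 (Space d)}
    (hθ : ∀ x, divg ζ x = θ x) :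
    ∀ s ∈ Icc t T,
      torusInt (fun x => inner ℝ (α s x) (ζ x)) + torusInt (fun x => φ s x * θ x) = 0 := by
  set A : ℝ → ℝ := fun s => torusInt (fun x => inner ℝ (α s x) (ζ x)) with hA
  set p : ℝ → ℝ := fun s => torusInt (fun x => φ s x * θ x) with hp
  set p' : ℝ → ℝ := fun s =>
    torusInt (fun x => adjointRHS 𝒯 Tadj D (F (q s)) (q s) (α s) x * θ x) with hp'
  have hθj : Continuous fun p : ℝ × Space d => θ p.2 := θ.continuous_coe.comp continuous_snd
  have hζj : Continuous fun p : ℝ × Space d => ζ p.2 := ζ.continuous_coe.comp continuous_snd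
  have hAc : Continuous A := continuous_torusInt (hα.torusC_apply.inner hζj)
  have hp'c : Continuous p' := continuous_torusInt (hKc.mul hθj)
  have hpd : ∀ s, HasDerivAt p (p' s) s := fun s =>
    hasDerivAt_torusInt (f := fun s x => φ s x * θ x) (fun r => (hφc r).mul θ.continuous_coe)
      (hKc.mul hθj) (fun r x => (hφ r x).mul_const _) s
  have hpc : Continuous p := continuous_iff_continuousAt.2 fun s => (hpd s).continuousAt
  have hχc : Continuous fun s => A s + p s := hAc.add hpc
  -- The time profile is chosen with derivative `χ = A + p`, the very quantity to be shown zero, so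
  -- that the first-order condition becomes the integral of its square.
  set X : ℝ → ℝ := fun s => ∫ r in t..s, (A r + p r) with hX
  have hXd : ∀ s, HasDerivAt X (A s + p s) s := fun s =>
    intervalIntegral.integral_hasDerivAt_right (hχc.intervalIntegrable _ _)
      (hχc.stronglyMeasurableAtFilter _ _) hχc.continuousAt
  have hXc : Continuous X := continuous_iff_continuousAt.2 fun s => (hXd s).continuousAt
  have hXt : X t = 0 := intervalIntegral.integral_same
  have hfo := h.first_order htT hF hG hFc hq hα hXd hχc hXt hθ
  have hFi : IntervalIntegrable (fun s => torusInt (fun x => F (q s) x * (-X s • θ) x))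
      volume t T := by
    refine ContinuousOn.intervalIntegrable_of_Icc htT.le ?_
    rw [continuousOn_iff_continuous_domRestrict]
    exact IsFunctionalDerivative.continuous_torusInt_mul (S := Icc t T)
      (η := fun s => -X s • θ) hFc (hq.comp continuous_subtype_val) (by fun_prop)
      fun s => h.1.state_pos s s.2
  have hki : IntervalIntegrable (fun s => torusInt (fun x =>
        inner ℝ (α s x) ((D • -X s • grad θ + (A s + p s) • ζ : TorusC d 1 (Space d)) x)
        - (-X s • θ) x * (1 / 2 * ‖α s x‖ ^ 2 + inner ℝ (α s x) (𝒯 (q s) x))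
        - q s x * inner ℝ (α s x) (𝒯 (-X s • θ) x))) volume t T := by
    have hη : Continuous fun s => -X s • θ := by fun_prop
    have hy : Continuous fun s => D • -X s • grad θ + (A s + p s) • ζ := by fun_prop
    have hαj := hα.torusC_apply
    refine (continuous_torusInt (S := ℝ) ?_).intervalIntegrable _ _
    exact ((hαj.inner hy.torusC_apply).sub (hη.torusC_apply.mul ((continuous_const.mul
      (hαj.norm.pow 2)).add (hαj.inner (𝒯.continuous.comp hq).torusC_apply)))).sub
      (hq.torusC_apply.mul (hαj.inner (𝒯.continuous.comp hη).torusC_apply))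
  rw [← add_assoc, ← intervalIntegral.integral_add hki hFi] at hfo
  simp only [torusInt_first_variation hadj] at hfo
  have hGT : torusInt (fun x => G (q T) x * (-X T • θ) x) = X T * p T := by
    rw [hp, ← torusInt_const_mul]
    congr 1
    funext x
    simp only [hφT, coe_smul, Pi.smul_apply, smul_eq_mul]
    ring
  -- Integration by parts in time trades the terminal term for `χ p + X p'`; adding the running term
  -- `χ A - X p'` leaves `χ (A + p) = χ²`.
  have hparts : ∫ s in t..T, ((A s + p s) * p s + X s * p' s) = X T * p T := by
    rw [intervalIntegral.integral_eq_sub_of_hasDerivAt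
      (f := fun s => X s * p s) (fun s _ => (hXd s).mul (hpd s))
      (((hχc.mul hpc).add (hXc.mul hp'c)).intervalIntegrable _ _), hXt]
    ring
  have hI₁ : IntervalIntegrable (fun s => (A s + p s) * A s + -X s * p' s) volume t T :=
    ((hχc.mul hAc).add (hXc.neg.mul hp'c)).intervalIntegrable _ _
  have hI₂ : IntervalIntegrable (fun s => (A s + p s) * p s + X s * p' s) volume t T :=
    ((hχc.mul hpc).add (hXc.mul hp'c)).intervalIntegrable _ _
  have hfo' : (∫ s in t..T, ((A s + p s) * A s + -X s * p' s)) + X T * p T = 0 := hGT ▸ hfo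
  rw [← hparts, ← intervalIntegral.integral_add hI₁ hI₂] at hfo'
  refine eqOn_zero_of_integral_sq_eq_zero hχc htT ?_
  rw [← hfo']
  congr 1
  funext s
  ring

/-- The first-order condition for an optimal pair which is continuous on the whole line. -/
theorem IsOptimal.exists_solvesMFG2 {ℱ 𝒢 : TorusC d 2 ℝ → ℝ}
    {F G : TorusC d 2 ℝ → TorusC d 0 ℝ} {q : ℝ → TorusC d 2 ℝ} {α : ℝ → TorusC d 1 (Space d)}
    (h : IsOptimal 𝒯 D t T (fun a => 1 / 2 * ‖a‖ ^ 2) ℱ 𝒢 q₀ q α) (hadj : IsL2Adjoint 𝒯 Tadj)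
    (htT : t < T) (hF : IsFunctionalDerivative ℱ F) (hG : IsFunctionalDerivative 𝒢 G)
    (hFc : ContinuousOn F {q | Pos q}) (hq : Continuous q) (hα : Continuous α)
    (hpos : ∀ s, Pos (q s)) :
    ∃ φ : ℝ → TorusC d 2 ℝ, (∀ s ∈ Icc t T, α s = grad (φ s)) ∧
      SolvesMFG2 𝒯 Tadj D t T F G q₀ q φ := by
  set K : ℝ → Space d → ℝ := fun s => adjointRHS 𝒯 Tadj D (F (q s)) (q s) (α s) with hK
  have hKc : Continuous fun p : ℝ × Space d => K p.1 p.2 :=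
    continuous_adjointRHS (hFc.comp_continuous hq hpos) hq hα
  -- With `α` in place of `∇φ` the backward equation is a plain time integral. Its terms are only
  -- continuous in `x`; the `C^2` regularity will come from the identification of the gradient.
  set Φ : ℝ → Space d → ℝ := fun s x => -G (q T) x + ∫ r in T..s, K r x with hΦ
  have hΦc : Continuous fun p : ℝ × Space d => Φ p.1 p.2 := by
    refine ((G (q T)).continuous_coe.comp continuous_snd).neg.add ?_
    exact intervalIntegral.continuous_parametric_intervalIntegral_of_continuous
      (f := fun (p : ℝ × Space d) r => K r p.2)
      (hKc.comp (continuous_snd.prodMk (continuous_snd.comp continuous_fst))) continuous_fst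
  have hΦs : ∀ s, Continuous (Φ s) := fun s =>
    hΦc.comp (by fun_prop : Continuous fun x => (s, x))
  have hΦd : ∀ s x, HasDerivAt (fun r => Φ r x) (K s x) s := by
    intro s x
    have hx : Continuous fun r => K r x := hKc.comp (by fun_prop : Continuous fun r => (r, x))
    exact (intervalIntegral.integral_hasDerivAt_right (hx.intervalIntegrable _ _)
      (hx.stronglyMeasurableAtFilter _ _) hx.continuousAt).const_add _
  have hΦT : ∀ x, Φ T x = -G (q T) x := fun x => by simp [hΦ]
  have hKp : ∀ s, IsPeriodic (K s) := by
    intro s x i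
    have hd : divg (α s) (x + EuclideanSpace.single i 1) = divg (α s) x := by
      simp only [divg, (α s).isPeriodic.fderiv x i]
    simp only [hK, adjointRHS, hd, (F (q s)).isPeriodic x i, (α s).isPeriodic x i,
      (𝒯 (q s)).isPeriodic x i, (Tadj (mulField (q s) (α s))).isPeriodic x i]
  have hΦp : ∀ s, IsPeriodic (Φ s) := by
    intro s x i
    simp only [hΦ, (G (q T)).isPeriodic x i, hKp _ x i]
  have hw : ∀ s ∈ Icc t T, ∀ x, HasFDerivAt (Φ s)
      (InnerProductSpace.toDual ℝ (Space d) (α s x)) x := by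
    intro s hs
    refine hasFDerivAt_of_weak_gradient (hΦs s) (hΦp s) (α s).continuous_coe (α s).isPeriodic ?_
    intro v ψ hψ hψp
    -- The field `ψ v` tests the derivative in direction `v`. Its divergence `∂_v ψ` must be a `C^2`
    -- state variation, whence test functions of class `C^3`.
    let ζ : TorusC d 1 (Space d) :=
      ⟨fun x => ψ x • v, (hψ.of_le (by norm_num)).smul contDiff_const,
        fun x i => by simp only [hψp x i]⟩
    let θ : TorusC d 2 ℝ :=
      ⟨fun x => fderiv ℝ ψ x v,
        (hψ.fderiv_right (m := 2) (by norm_num)).clm_apply contDiff_const,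
        fun x i => by simp only [hψp.fderiv x i]⟩
    have hθ : ∀ x, divg ζ x = θ x := by
      intro x
      have h1 : divg (fun y => ψ y • v) x = ψ x * divg (fun _ => v) x + fderiv ℝ ψ x v :=
        divg_smul (hψ.differentiable (by norm_num) x) (differentiableAt_const v)
      have h2 : divg (fun _ : Space d => v) x = 0 := by simp [divg]
      rw [h2, mul_zero, zero_add] at h1
      exact h1
    have h1 := h.weak_gradient hadj htT hF hG hFc hq hα hΦs hKc hΦd hΦT hθ s hs
    have h2 : ∀ x, inner ℝ (α s x) (ζ x) = inner ℝ (α s x) v * ψ x := by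
      intro x
      have : ζ x = ψ x • v := rfl
      rw [this, real_inner_smul_right, mul_comm]
    simp only [h2] at h1
    exact eq_neg_of_add_eq_zero_left h1
  have hmem : ∀ s ∈ Icc t T, ContDiff ℝ (2 : ℕ) (Φ s) ∧ IsPeriodic (Φ s) := by
    intro s hs
    refine ⟨?_, hΦp s⟩
    -- The derivative of `Φ s` is the `C^1` field `α s` under the Riesz map, which gains one order.
    have h1 : ContDiff ℝ ((1 : ℕ) + 1) (Φ s) :=
      contDiff_succ_iff_hasFDerivAt.2 ⟨fun x => InnerProductSpace.toDual ℝ (Space d) (α s x),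
        (InnerProductSpace.toDual ℝ (Space d)).contDiff.comp (α s).contDiff, hw s hs⟩
    exact_mod_cast h1
  classical
  let φ : ℝ → TorusC d 2 ℝ := fun s => if hs : s ∈ Icc t T then ⟨Φ s, hmem s hs⟩ else 0
  have hφ : ∀ s ∈ Icc t T, ⇑(φ s) = Φ s := by
    intro s hs
    have : φ s = _ := dif_pos hs
    rw [this]
    rfl
  have hgrad : ∀ s ∈ Icc t T, grad (φ s) = α s := by
    intro s hs
    refine DFunLike.coe_injective (funext fun x => ?_)
    rw [grad_apply, gradient, hφ s hs, (hw s hs x).fderiv, LinearIsometryEquiv.symm_apply_apply]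
  refine ⟨φ, fun s hs => (hgrad s hs).symm, ?_⟩
  refine ⟨h.1.state_continuous, ?_, ?_, h.1.initial, ?_, ?_⟩
  · rw [continuousOn_iff_continuous_domRestrict]
    refine continuous_of_continuous_grad (S := Icc t T) ?_ ?_
    · have h1 : ∀ p : Icc t T × Space d, (Icc t T).domRestrict φ p.1 p.2 = Φ p.1 p.2 :=
        fun p => congrFun (hφ p.1 p.1.2) p.2
      simp only [h1]
      exact hΦc.comp (by fun_prop : Continuous fun p : Icc t T × Space d => ((p.1 : ℝ), p.2))
    · have h1 : ∀ s : Icc t T, grad ((Icc t T).domRestrict φ s) = α s := fun s => hgrad s s.2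
      simp only [h1]
      exact hα.comp continuous_subtype_val
  · intro s hs x
    rw [hgrad s hs]
    exact h.1.continuity s hs x
  · intro s hs x
    refine ⟨K s x, ?_, ?_⟩
    · exact (hΦd s x).hasDerivWithinAt.congr (fun r hr => congrFun (hφ r hr) x)
        (congrFun (hφ s hs) x)
    · rw [← divg_grad, hgrad s hs]
      simp only [hK, adjointRHS]
      ring
  · intro x
    rw [hφ T (right_mem_Icc.2 htT.le), hΦT]

theorem IsAdmissible.congr {q q' : ℝ → TorusC d 2 ℝ} {α α' : ℝ → TorusC d 1 (Space d)}
    (h : IsAdmissible 𝒯 D t T q₀ q α) (htT : t ≤ T) (hq : EqOn q' q (Icc t T))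
    (hα : EqOn α' α (Icc t T)) : IsAdmissible 𝒯 D t T q₀ q' α' where
  state_continuous := h.state_continuous.congr hq
  control_continuous := h.control_continuous.congr hα
  state_pos s hs := hq hs ▸ h.state_pos s hs
  initial := (hq (left_mem_Icc.2 htT)).trans h.initial
  continuity s hs x := by
    rw [hq hs, hα hs]
    exact (h.continuity s hs x).congr (fun r hr => by rw [hq hr]) (by rw [hq hs])

theorem cost_congr {L : Space d → ℝ} {ℱ 𝒢 : TorusC d 2 ℝ → ℝ} {q q' : ℝ → TorusC d 2 ℝ}
    {α α' : ℝ → TorusC d 1 (Space d)} (htT : t ≤ T) (hq : EqOn q' q (Icc t T))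
    (hα : EqOn α' α (Icc t T)) : cost L ℱ 𝒢 t T q' α' = cost L ℱ 𝒢 t T q α := by
  rw [cost, cost, hq (right_mem_Icc.2 htT)]
  congr 1
  refine intervalIntegral.integral_congr fun s hs => ?_
  rw [uIcc_of_le htT] at hs
  simp only [hq hs, hα hs]

theorem SolvesMFG2.congr {F G : TorusC d 2 ℝ → TorusC d 0 ℝ} {q q' φ : ℝ → TorusC d 2 ℝ}
    (h : SolvesMFG2 𝒯 Tadj D t T F G q₀ q φ) (htT : t ≤ T) (hq : EqOn q' q (Icc t T)) :
    SolvesMFG2 𝒯 Tadj D t T F G q₀ q' φ where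
  state_continuous := h.state_continuous.congr hq
  adjoint_continuous := h.adjoint_continuous
  forward s hs x := by
    rw [hq hs]
    exact (h.forward s hs x).congr (fun r hr => by rw [hq hr]) (by rw [hq hs])
  initial := (hq (left_mem_Icc.2 htT)).trans h.initial
  backward s hs x := by
    rw [hq hs]
    exact h.backward s hs x
  terminal x := by
    rw [hq (right_mem_Icc.2 htT)]
    exact h.terminal x

end MFG

end

theorem mainTheorem5 (d : ℕ)
    (𝒯 : MFG.TorusC d 2 ℝ →L[ℝ] MFG.TorusC d 1 (MFG.Space d))
    (Tadj : MFG.TorusC d 1 (MFG.Space d) →L[ℝ] MFG.TorusC d 0 ℝ)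
    (hadj : MFG.IsL2Adjoint 𝒯 Tadj)
    (D t T : ℝ) (hD : 0 ≤ D) (htT : t < T)
    (ℱ 𝒢 : MFG.TorusC d 2 ℝ → ℝ) (F G : MFG.TorusC d 2 ℝ → MFG.TorusC d 0 ℝ)
    (hF : MFG.IsFunctionalDerivative ℱ F) (hG : MFG.IsFunctionalDerivative 𝒢 G)
    (hFc : ContinuousOn F {q | MFG.Pos q})
    (q₀ : MFG.TorusC d 2 ℝ)
    (q : ℝ → MFG.TorusC d 2 ℝ) (α : ℝ → MFG.TorusC d 1 (MFG.Space d))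
    (hopt : MFG.IsOptimal 𝒯 D t T (fun a => 1 / 2 * ‖a‖ ^ 2) ℱ 𝒢 q₀ q α) :
    ∃ φ : ℝ → MFG.TorusC d 2 ℝ,
      (∀ s ∈ Icc t T, α s = MFG.TorusC.grad (φ s)) ∧
      MFG.SolvesMFG2 𝒯 Tadj D t T F G q₀ q φ := by
  -- Projecting time onto `[t,T]` extends the curves by their endpoint values to continuous curves
  -- on the line with positive states. Admissibility, cost and the system see only `[t,T]`, so
  -- optimality passes to the extension and the solution passes back.
  have hc : Continuous fun s => ((projIcc t T htT.le s : Icc t T) : ℝ) :=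
    continuous_subtype_val.comp continuous_projIcc
  have hmem : ∀ s, ((projIcc t T htT.le s : Icc t T) : ℝ) ∈ Icc t T :=
    fun s => (projIcc t T htT.le s).2
  have hproj : ∀ s ∈ Icc t T, ((projIcc t T htT.le s : Icc t T) : ℝ) = s :=
    fun s hs => by rw [projIcc_of_mem htT.le hs]
  have hq : EqOn (fun s => q (projIcc t T htT.le s)) q (Icc t T) :=
    fun s hs => congrArg q (hproj s hs)
  have hα : EqOn (fun s => α (projIcc t T htT.le s)) α (Icc t T) :=
    fun s hs => congrArg α (hproj s hs)
  have hopt' : MFG.IsOptimal 𝒯 D t T (fun a => 1 / 2 * ‖a‖ ^ 2) ℱ 𝒢 q₀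
      (fun s => q (projIcc t T htT.le s)) (fun s => α (projIcc t T htT.le s)) :=
    ⟨hopt.1.congr htT.le hq hα, fun q' α' h => by
      rw [MFG.cost_congr htT.le hq hα]
      exact hopt.2 q' α' h⟩
  obtain ⟨φ, hφ, hsol⟩ := hopt'.exists_solvesMFG2 hadj htT hF hG hFc
    (hopt.1.state_continuous.comp_continuous hc hmem)
    (hopt.1.control_continuous.comp_continuous hc hmem)
    (fun s => hopt.1.state_pos _ (hmem s))
  exact ⟨φ, fun s hs => (hα hs).symm.trans (hφ s hs), hsol.congr htT.le hq.symm⟩
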